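/- Let $n \ge 0$ and $r \ge 1$ be integers. A real symmetric $n\times n$ matrix $S=[s_{ij}]$ of rank $r$ is a Mandelstam matrix if $s_{ii}\ge 0$ for all $i$ and, counted with multiplicity, $S$ has precisely one positive eigenvalue and $r-1$ negative eigenvalues. Let $\mathcal{M}^0_{n,r}$ be the set of Mandelstam matrices of rank $r$ with $s_{11}=\cdots=s_{nn}=0$. A (rank-two) matroid $P$ on $[n]=\{1,\dots,n\}$ is a partition $P_1\sqcup\cdots\sqcup P_m$ of a subset of $[n]$ into $m\ge 2$ non-empty parts. Its bases are the pairs $\{i,j\}$ whose elements lie in different parts, and its loops are the elements of $[n]$ that lie in no part; let $l$ be the number of loops. A signed matroid is a pair $(P,\sigma)$ with $P$ a matroid and $\sigma\in\{-1,+1\}^n$, where $(P,\sigma)$ and $(P,\sigma')$ are identified if, for one global sign $\varepsilon\in\{\pm1\}$, $\sigma'_i=\varepsilon\sigma_i$ for all non-loops $i$ of $P$. Let $\mathcal{M}^0_{P,\sigma,r}$ be the set of all $S\in\mathcal{M}^0_{n,r}$ with $\operatorname{sign}(s_{ij})=\sigma_i\sigma_j$ if $\{i,j\}$ is a basis of $P$,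 and $s_{ij}=0$ otherwise. Then $\mathcal{M}^0_{n,r}$ is the disjoint union $$\mathcal{M}^0_{n,r} \;=\; \bigsqcup_{(P,\sigma)} \mathcal{M}^0_{P,\sigma,r},$$ where $(P,\sigma)$ runs over all signed matroids on $[n]$. The stratum $\mathcal{M}^0_{P,\sigma,r}$ is non-empty if and only if $3\le r\le m$ or $r=m=2$. If this holds, then its dimension as a semialgebraic set (the Krull dimension of the ring of polynomial functions on it) is $$\dim \mathcal{M}^0_{P,\sigma,r} \;=\; m(r-2)+n-l-\binom r2 .$$ -/

import Mathlib

namespace Kinematic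

/-- A Mandelstam matrix of rank `r`: a real symmetric `n × n` matrix of rank `r` with non-negative
diagonal that has precisely one positive and `r - 1` negative eigenvalues. Here `eigenvalues` lists
all eigenvalues with multiplicity (`IsHermitian` means symmetric, the entries being real). -/
structure IsMandelstam {n : ℕ} (S : Matrix (Fin n) (Fin n) ℝ) (r : ℕ) : Prop where
  isHermitian : S.IsHermitian
  rank_eq : S.rank = r
  diag_nonneg : ∀ i, 0 ≤ S i i
  card_pos : (Finset.univ.filter fun i => 0 < isHermitian.eigenvalues i).card = 1
  card_neg : (Finset.univ.filter fun i => isHermitian.eigenvalues i < 0).card = r - 1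

/-- The Mandelstam region: all Mandelstam matrices of size `n` and rank `r`. -/
def mandelstamRegion (n r : ℕ) : Set (Matrix (Fin n) (Fin n) ℝ) :=
  {S | IsMandelstam S r}

/-- The massless Mandelstam region: Mandelstam matrices with zero diagonal. -/
def masslessRegion (n r : ℕ) : Set (Matrix (Fin n) (Fin n) ℝ) :=
  {S | S ∈ mandelstamRegion n r ∧ ∀ i, S i i = 0}

/-- A rank-two matroid on `[n]`: a partition, into `m ≥ 2` (non-empty) parts, of a subset `support`
of `[n]`. The parts are the parallel classes. -/
structure RankTwoMatroid (n : ℕ) where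
  support : Finset (Fin n)
  partition : Finpartition support
  two_le_card : 2 ≤ partition.parts.card

namespace RankTwoMatroid

variable {n : ℕ}

/-- The number `m` of parts. -/
def numParts (P : RankTwoMatroid n) : ℕ := P.partition.parts.card

/-- The set of loops. -/
def loops (P : RankTwoMatroid n) : Finset (Fin n) := Finset.univ \ P.support

/-- The number `l` of loops. -/
def numLoops (P : RankTwoMatroid n) : ℕ := P.loops.card

/-- `{i, j}` is a basis: `i` and `j` lie in different parts. -/
def IsBasis (P : RankTwoMatroid n) (i j : Fin n) : Prop :=
  ∃ A ∈ P.partition.parts, ∃ B ∈ P.partition.parts, A ≠ B ∧ i ∈ A ∧ j ∈ B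

theorem IsBasis.mem_support {P : RankTwoMatroid n} {i j : Fin n} (h : P.IsBasis i j) :
    i ∈ P.support ∧ j ∈ P.support := by
  obtain ⟨A, hA, B, hB, -, hi, hj⟩ := h
  exact ⟨P.partition.le hA hi, P.partition.le hB hj⟩

end RankTwoMatroid

/-- The stratum of the pair `(P, σ)` in rank `r`: the massless Mandelstam matrices with
`sign s_ij = σ_i σ_j` if `{i, j}` is a basis of `P`, and `s_ij = 0` otherwise. -/
def kinematicStratum {n : ℕ} (P : RankTwoMatroid n) (σ : Fin n → ℤˣ) (r : ℕ) :
    Set (Matrix (Fin n) (Fin n) ℝ) :=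
  {S | S ∈ masslessRegion n r ∧
    (∀ i j, P.IsBasis i j → SignType.sign (S i j) = SignType.sign ((σ i * σ j : ℤˣ) : ℤ)) ∧
    (∀ i j, ¬ P.IsBasis i j → S i j = 0)}

/-- Two pairs `(P, σ)`, `(P', σ')` are the same signed matroid if `P = P'` and the sign vectors
agree on all non-loops, up to a global change of sign. -/
def signedMatroidSetoid (n : ℕ) : Setoid (RankTwoMatroid n × (Fin n → ℤˣ)) where
  r x y := x.1 = y.1 ∧
    ((∀ i ∈ x.1.support, x.2 i = y.2 i) ∨ (∀ i ∈ x.1.support, x.2 i = - y.2 i))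
  iseqv := by
    refine ⟨fun x => ⟨rfl, Or.inl fun _ _ => rfl⟩, ?_, ?_⟩
    · rintro ⟨P, σ⟩ ⟨P', τ⟩ ⟨h, h'⟩
      obtain rfl : P = P' := h
      refine ⟨rfl, h'.imp (fun h i hi => (h i hi).symm) (fun h i hi => ?_)⟩
      have := h i hi
      simp_all
    · rintro ⟨P, σ⟩ ⟨P', τ⟩ ⟨P'', ρ⟩ ⟨h, h'⟩ ⟨k, k'⟩
      obtain rfl : P = P' := h
      obtain rfl : P = P'' := k
      refine ⟨rfl, ?_⟩
      rcases h' with h | h <;> rcases k' with k | k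
      · exact Or.inl fun i hi => (h i hi).trans (k i hi)
      · exact Or.inr fun i hi => (h i hi).trans (k i hi)
      · exact Or.inr fun i hi => (h i hi).trans (congrArg _ (k i hi))
      · exact Or.inl fun i hi => (h i hi).trans ((congrArg _ (k i hi)).trans (neg_neg _))

/-- Signed rank-two matroids on `[n]`. -/
def SignedMatroid (n : ℕ) : Type := Quotient (signedMatroidSetoid n)

theorem kinematicStratum_congr {n : ℕ} (r : ℕ) (x y : RankTwoMatroid n × (Fin n → ℤˣ))
    (h : (signedMatroidSetoid n).r x y) :
    kinematicStratum x.1 x.2 r = kinematicStratum y.1 y.2 r := by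
  obtain ⟨P, σ⟩ := x
  obtain ⟨P', τ⟩ := y
  obtain ⟨h, h'⟩ := h
  obtain rfl : P = P' := h
  have key : ∀ i j, P.IsBasis i j → σ i * σ j = τ i * τ j := by
    intro i j hij
    obtain ⟨hi, hj⟩ := hij.mem_support
    rcases h' with h | h
    · exact congrArg₂ _ (h i hi) (h j hj)
    · exact (congrArg₂ _ (h i hi) (h j hj)).trans (neg_mul_neg _ _)
  ext S
  refine and_congr_right fun _ => and_congr_left fun _ => ?_
  refine forall_congr' fun i => forall_congr' fun j => forall_congr' fun hij => ?_
  rw [key i j hij]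

/-- The kinematic stratum of a signed matroid. -/
def SignedMatroid.stratum {n : ℕ} (Q : SignedMatroid n) (r : ℕ) :
    Set (Matrix (Fin n) (Fin n) ℝ) :=
  Quotient.lift (fun x : RankTwoMatroid n × (Fin n → ℤˣ) => kinematicStratum x.1 x.2 r)
    (kinematicStratum_congr r) Q

/-- The dimension of a semialgebraic set `A ⊆ ℝ^ι` (as in Bochnak, Coste and Roy): the Krull
dimension of the ring `ℝ[x_i : i ∈ ι] / I(A)` of polynomial functions on `A`, where `I(A)` is the
ideal of all polynomials that vanish on `A`. -/
noncomputable def semialgebraicDim {ι : Type*} (A : Set (ι → ℝ)) : WithBot ℕ∞ :=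
  ringKrullDim (MvPolynomial ι ℝ ⧸ MvPolynomial.vanishingIdeal ℝ A)

/-- The dimension of a semialgebraic set of matrices, in the coordinates given by the entries. -/
noncomputable def matrixDim {n : ℕ} (A : Set (Matrix (Fin n) (Fin n) ℝ)) : WithBot ℕ∞ :=
  semialgebraicDim {x : Fin n × Fin n → ℝ | Matrix.of (fun i j => x (i, j)) ∈ A}

end Kinematic

namespace Kinematic

open Matrix MvPolynomial

/-! The spectral theorem writes a Mandelstam matrix as a Gram matrix of vectors `(u_i, w_i)` in
Minkowski space `ℝ^{1,r-1}`. With zero diagonal these vectors are null, and `s_ij = u_i u_j |g_i -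
g_j|² / 2` with `g_i = w_i / u_i` on the sphere `S^{r-2}` whenever `u_i ≠ 0` (`exists_directions`).
So loops are the zeros of `u`, parallel classes are the fibres of `g`, and `σ` is the sign of `u`:
the strata cover, and a matrix determines its signed matroid. Rows in one class are proportional, so
`r ≤ m`; the sphere is empty for `r = 1` and has two points for `r = 2`, so `r = 2` forces `m = 2`.

For existence and dimension put `k = r - 2`, `N = m - 2` and use light-cone coordinates. One class
is sent to infinity and one to the origin, and the other `N` become points of `ℝ^k`. Unscaled
vectors have product `1` with infinity and otherwise the squared distance of their points. Rotations
of `ℝ^k` make the `k × N` matrix of points upper triangular, and one scale can be normalised to `1`.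
This leaves `(n - l - 1) + kN - k(k-1)/2` parameters, which is the asserted dimension.

The stratum lies between the image of a box with infinite sides and the image of the whole parameter
space under this polynomial map (`entry_mem_stratum`, `exists_eq_entry`). Its coordinate ring is
therefore the algebra generated by the matrix entries. The parameters are recovered from the entries
by field operations and square roots, as in a Cholesky decomposition (`param_mem`), so the
transcendence degree, hence the Krull dimension, is the number of parameters
(`semialgebraicDim_eq_card`). -/

/-! ### Krull dimension, transcendence degree and images of polynomial maps. -/

/-- Incomparability gives `≤`; lying over and going up lift chains of primes and give `≥`. -/
theorem ringKrullDim_eq_of_isIntegral {R S : Type*} [CommRing R] [CommRing S] [Algebra R S]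
    [Algebra.IsIntegral R S] (hinj : Function.Injective (algebraMap R S)) :
    ringKrullDim S = ringKrullDim R := by
  apply le_antisymm
  · refine Order.krullDim_le_of_strictMono (PrimeSpectrum.comap (algebraMap R S)) ?_
    intro p q hpq
    have h : p.asIdeal < q.asIdeal := hpq
    exact Ideal.IsIntegral.comap_lt_comap h
  · refine iSup_le fun l => ?_
    obtain ⟨Q, hQp, hQ⟩ : ∃ Q : Ideal S, Q.IsPrime ∧ Q.LiesOver l.head.asIdeal := by
      obtain ⟨Q, -, hQ, hQ'⟩ := Ideal.exists_ideal_over_prime_of_isIntegral (S := S)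
        l.head.asIdeal ⊥ (by
          rw [← RingHom.ker_eq_comap_bot, (RingHom.injective_iff_ker_eq_bot _).1 hinj]
          exact bot_le)
      exact ⟨Q, hQ, ⟨hQ'.symm⟩⟩
    obtain ⟨L, hL, -, -⟩ := Ideal.exists_ltSeries_of_hasGoingUp l Q
    rw [← hL]
    exact le_iSup (fun p : LTSeries (PrimeSpectrum S) => ((p.length : ℕ) : WithBot ℕ∞)) L

/-- By Noether normalisation `R` is integral over a polynomial ring, for which both invariants equal
the number of variables. -/
theorem ringKrullDim_eq_of_trdeg {k : Type*} {R : Type*} [Field k] [CommRing R] [IsDomain R]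
    [Algebra k R] [Algebra.FiniteType k R] {d : ℕ} (h : Algebra.trdeg k R = d) :
    ringKrullDim R = d := by
  obtain ⟨s, g, hg, hint⟩ := exists_integral_inj_algHom_of_fg k R
  let _ := g.toRingHom.toAlgebra
  have : IsScalarTower k (MvPolynomial (Fin s) k) R := IsScalarTower.of_algHom g
  have : Algebra.IsIntegral (MvPolynomial (Fin s) k) R := ⟨hint⟩
  have hinj : Function.Injective (algebraMap (MvPolynomial (Fin s) k) R) := hg
  have hf : FaithfulSMul (MvPolynomial (Fin s) k) R :=
    (faithfulSMul_iff_algebraMap_injective _ _).2 hinj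
  rw [ringKrullDim_eq_of_isIntegral hinj, MvPolynomial.ringKrullDim_of_isNoetherianRing]
  have h1 := lift_trdeg_add_eq k (MvPolynomial (Fin s) k) R
  rw [h, trdeg_eq_zero (R := MvPolynomial (Fin s) k) (A := R), MvPolynomial.trdeg_of_isDomain] at h1
  simp at h1
  simp [h1, ringKrullDim_eq_zero_of_field]

/-- A subset of affine space that is squeezed between the images of a box with infinite sides and
of the whole parameter space under a polynomial map has as its dimension the number of parameters,
provided that the parameters are algebraic over the entries of the map. -/
theorem semialgebraicDim_eq_card {ι τ : Type} [Finite ι] [Fintype τ] (Φ : ι → MvPolynomial τ ℝ)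
    (A : Set (ι → ℝ)) (s : τ → Set ℝ) (hs : ∀ i, (s i).Infinite)
    (hbox : ∀ t ∈ Set.pi Set.univ s, (fun i => eval t (Φ i)) ∈ A)
    (hcover : ∀ x ∈ A, ∃ t, x = fun i => eval t (Φ i))
    (halg : ∀ K : IntermediateField ℝ (FractionRing (MvPolynomial τ ℝ)),
      (∀ i, algebraMap _ _ (Φ i) ∈ K) → (∀ x, x ^ 2 ∈ K → x ∈ K) →
      ∀ j, algebraMap _ _ (X j : MvPolynomial τ ℝ) ∈ K) :
    semialgebraicDim A = Fintype.card τ := by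
  have hker : vanishingIdeal ℝ A = RingHom.ker (aeval Φ : MvPolynomial ι ℝ →ₐ[ℝ] _) := by
    have key : ∀ (p : MvPolynomial ι ℝ) (t : τ → ℝ),
        aeval (fun i => eval t (Φ i)) p = eval t (aeval Φ p) := by
      intro p t
      have := MvPolynomial.comp_aeval_apply (R := ℝ) Φ (aeval t : MvPolynomial τ ℝ →ₐ[ℝ] ℝ) p
      simpa [MvPolynomial.aeval_eq_eval] using this.symm
    ext p
    rw [mem_vanishingIdeal_iff, RingHom.mem_ker]
    constructor
    · intro h
      -- A polynomial that vanishes on a product of infinite sets is zero.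
      refine funext_set s hs fun t ht => ?_
      have := h _ (hbox t ht)
      rw [key] at this
      simpa using this
    · intro h x hx
      obtain ⟨t, rfl⟩ := hcover x hx
      rw [key]
      have h' : aeval Φ p = 0 := h
      rw [h', map_zero]
  have e : (MvPolynomial ι ℝ ⧸ vanishingIdeal ℝ A) ≃+* (aeval Φ : MvPolynomial ι ℝ →ₐ[ℝ] _).range :=
    (Ideal.quotEquivOfEq hker).trans
      (Ideal.quotientKerEquivRange (aeval Φ : MvPolynomial ι ℝ →ₐ[ℝ] _)).toRingEquiv
  rw [semialgebraicDim, ringKrullDim_eq_of_ringEquiv e]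
  set B := (aeval Φ : MvPolynomial ι ℝ →ₐ[ℝ] MvPolynomial τ ℝ).range with hB
  have hft : Algebra.FiniteType ℝ B :=
    Algebra.FiniteType.of_surjective (aeval Φ).rangeRestrict (AlgHom.rangeRestrict_surjective _)
  apply ringKrullDim_eq_of_trdeg (k := ℝ)
  have hBalg : Algebra.IsAlgebraic B (MvPolynomial τ ℝ) := by
    let L := FractionRing (MvPolynomial τ ℝ)
    have hinj : Function.Injective (algebraMap (MvPolynomial τ ℝ) L) := IsFractionRing.injective _ _
    -- The elements of `L` algebraic over `B` form a field closed under square roots, so `halg`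
    -- applies to it.
    let K : IntermediateField ℝ L :=
      { (Subalgebra.algebraicClosure B L).restrictScalars ℝ with
        inv_mem' := fun x hx => IsAlgebraic.inv hx }
    have hK : ∀ x : L, x ∈ K ↔ IsAlgebraic B x := fun x => Iff.rfl
    have hX : ∀ j, IsAlgebraic B (X j : MvPolynomial τ ℝ) := by
      intro j
      rw [← isAlgebraic_algebraMap_iff hinj, ← hK]
      refine halg K (fun i => ?_) (fun x hx => ?_) j
      · rw [hK]
        have hi : Φ i ∈ B := ⟨X i, by simp⟩
        have := isAlgebraic_algebraMap (A := L) (⟨Φ i, hi⟩ : B)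
        rwa [IsScalarTower.algebraMap_apply B (MvPolynomial τ ℝ) L] at this
      · exact IsAlgebraic.of_pow two_pos ((hK _).1 hx)
    refine ⟨fun p => ?_⟩
    induction p using MvPolynomial.induction_on with
    | C a =>
      have := isAlgebraic_algebraMap (R := B) (A := MvPolynomial τ ℝ) (algebraMap ℝ B a)
      rwa [← IsScalarTower.algebraMap_apply ℝ B (MvPolynomial τ ℝ)] at this
    | add p q hp hq => exact hp.add hq
    | mul_X p i hp => exact hp.mul (hX i)
  have hf : FaithfulSMul ℝ B :=
    (faithfulSMul_iff_algebraMap_injective _ _).2 (algebraMap ℝ B).injective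
  have h1 := trdeg_add_eq ℝ B (A := MvPolynomial τ ℝ)
  rw [trdeg_eq_zero (R := B) (A := MvPolynomial τ ℝ), MvPolynomial.trdeg_of_isDomain] at h1
  simpa using h1

/-! ### Lorentzian Gram matrices and their signature. -/

theorem _root_.Matrix.IsHermitian.apply_eq_sum_eigenvalues {n : Type*} [Fintype n] [DecidableEq n]
    {S : Matrix n n ℝ} (hS : S.IsHermitian) (i j : n) :
    S i j = ∑ e, hS.eigenvalues e * hS.eigenvectorBasis e i * hS.eigenvectorBasis e j := by
  conv_lhs => rw [hS.spectral_theorem, Unitary.conjStarAlgAut_apply]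
  rw [Matrix.mul_apply]
  refine Finset.sum_congr rfl fun e _ => ?_
  rw [Matrix.mul_diagonal]
  simp [Matrix.star_apply, Matrix.IsHermitian.eigenvectorUnitary_apply]
  exact Or.inl (mul_comm _ _)

theorem IsMandelstam.exists_lorentz_gram {n r : ℕ} {S : Matrix (Fin n) (Fin n) ℝ}
    (h : IsMandelstam S r) :
    ∃ (u : Fin n → ℝ) (w : Fin (r - 1) → Fin n → ℝ),
      ∀ i j, S i j = u i * u j - ∑ e, w e i * w e j := by
  classical
  set hS := h.isHermitian
  obtain ⟨p, hp⟩ := Finset.card_eq_one.1 h.card_pos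
  have ec : Fintype.card {e // hS.eigenvalues e < 0} = Fintype.card (Fin (r - 1)) := by
    rw [Fintype.card_subtype, h.card_neg, Fintype.card_fin]
  let e := Fintype.equivOfCardEq ec
  have hpp : 0 < hS.eigenvalues p := by
    have : p ∈ Finset.univ.filter fun i => 0 < hS.eigenvalues i := by rw [hp]; simp
    simpa using this
  have hpu : ∀ q, 0 < hS.eigenvalues q → q = p := by
    intro q hq
    have : q ∈ Finset.univ.filter fun i => 0 < hS.eigenvalues i := by simpa using hq
    rw [hp] at this
    simpa using this
  refine ⟨fun i => √(hS.eigenvalues p) * hS.eigenvectorBasis p i,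
    fun a i => √(-hS.eigenvalues (e.symm a)) * hS.eigenvectorBasis (e.symm a).1 i, fun i j => ?_⟩
  rw [hS.apply_eq_sum_eigenvalues i j]
  have h1 : ∑ a, √(-hS.eigenvalues (e.symm a)) * hS.eigenvectorBasis (e.symm a).1 i *
      (√(-hS.eigenvalues (e.symm a)) * hS.eigenvectorBasis (e.symm a).1 j) =
      ∑ q : {e // hS.eigenvalues e < 0}, √(-hS.eigenvalues q) * hS.eigenvectorBasis q.1 i *
      (√(-hS.eigenvalues q) * hS.eigenvectorBasis q.1 j) :=
    Fintype.sum_equiv e.symm _ _ fun _ => rfl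
  rw [h1, eq_sub_iff_add_eq,
    ← Finset.sum_subtype (Finset.univ.filter fun e => hS.eigenvalues e < 0) (by simp)
      (fun q => √(-hS.eigenvalues q) * hS.eigenvectorBasis q i *
      (√(-hS.eigenvalues q) * hS.eigenvectorBasis q j)), Finset.sum_filter,
    ← Finset.sum_add_distrib, Finset.sum_eq_single p]
  · rw [if_neg hpp.not_gt]
    have := Real.mul_self_sqrt hpp.le
    linear_combination (-hS.eigenvectorBasis p i * hS.eigenvectorBasis p j) * this
  · intro q _ hq
    split_ifs with hq'
    · have := Real.mul_self_sqrt (neg_nonneg.2 hq'.le)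
      linear_combination (hS.eigenvectorBasis q i * hS.eigenvectorBasis q j) * this
    · have : hS.eigenvalues q = 0 :=
        le_antisymm (not_lt.1 fun h => hq (hpu q h)) (not_lt.1 hq')
      simp [this]
  · simp

/-- A symmetric bilinear form that is bounded above by the square of a linear form has no
two-dimensional positive definite subspace. -/
theorem not_pos_of_orthogonal_of_le_sq {V : Type*} [AddCommGroup V] [Module ℝ V]
    (B : LinearMap.BilinForm ℝ V) (f : V →ₗ[ℝ] ℝ) (hB : ∀ v, B v v ≤ f v ^ 2) {x y : V}
    (hxy : B x y = 0) (hyx : B y x = 0) (hy : 0 < B y y) : B x x ≤ 0 := by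
  by_contra! hx
  -- This vector lies in the kernel of `f`, so the form is at most `0` on it.
  have h := hB (f y • x - f x • y)
  simp only [map_sub, map_smul, LinearMap.sub_apply, LinearMap.smul_apply, smul_eq_mul, hxy,
    hyx] at h
  have hfy : f y ≠ 0 := by
    intro h0
    have := hB y
    rw [h0] at this
    nlinarith
  have : 0 < f y ^ 2 * B x x := by positivity
  have h' : 0 ≤ f x ^ 2 * B y y := by positivity
  nlinarith

theorem toBilin'_le_sq {n m : Type*} [Fintype n] [DecidableEq n] [Fintype m]
    {S : Matrix n n ℝ} {u : n → ℝ} {w : m → n → ℝ}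
    (h : ∀ i j, S i j = u i * u j - ∑ e, w e i * w e j) (v : n → ℝ) :
    Matrix.toBilin' S v v ≤ (∑ i, u i * v i) ^ 2 := by
  have : Matrix.toBilin' S v v = (∑ i, u i * v i) ^ 2 - ∑ e, (∑ i, w e i * v i) ^ 2 := by
    rw [Matrix.toBilin'_apply]
    simp_rw [h, mul_sub, sub_mul, Finset.sum_sub_distrib, pow_two, Finset.sum_mul_sum,
      Finset.mul_sum, Finset.sum_mul]
    congr 1
    · exact Finset.sum_congr rfl fun i _ => Finset.sum_congr rfl fun j _ => by ring
    · rw [Finset.sum_comm]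
      conv_rhs => rw [Finset.sum_comm]
      rw [Finset.sum_comm]
      refine Finset.sum_congr rfl fun i _ => ?_
      rw [Finset.sum_comm]
      exact Finset.sum_congr rfl fun e _ => Finset.sum_congr rfl fun j _ => by ring
  rw [this]
  have : 0 ≤ ∑ e, (∑ i, w e i * v i) ^ 2 := Finset.sum_nonneg fun _ _ => sq_nonneg _
  linarith

/-- The linear form with coefficients `u`. -/
noncomputable def dotLinear {n : Type*} [Fintype n] (u : n → ℝ) : (n → ℝ) →ₗ[ℝ] ℝ :=
  ∑ i, u i • LinearMap.proj i

theorem dotLinear_apply {n : Type*} [Fintype n] (u v : n → ℝ) :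
    dotLinear u v = ∑ i, u i * v i := by
  simp [dotLinear]

/-- The form is bounded by the square of `u`, so there is at most one positive eigenvalue. There is
at least one, since the trace vanishes and `S ≠ 0`. The rank then fixes the number of negative ones.
-/
theorem isMandelstam_of_lorentz_gram {n r : ℕ} {m : Type*} [Fintype m]
    {S : Matrix (Fin n) (Fin n) ℝ} {u : Fin n → ℝ} {w : m → Fin n → ℝ} (hr : 1 ≤ r)
    (h : ∀ i j, S i j = u i * u j - ∑ e, w e i * w e j) (hrank : S.rank = r)
    (hdiag : ∀ i, S i i = 0) : IsMandelstam S r := by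
  have hS : S.IsHermitian := by
    ext i j
    simp only [conjTranspose_apply, star_trivial, h, mul_comm]
  have hne : S ≠ 0 := by
    rintro rfl
    simp at hrank
    omega
  have hpos : (Finset.univ.filter fun i => 0 < hS.eigenvalues i).card = 1 := by
    apply le_antisymm
    · rw [Finset.card_le_one]
      intro p hp q hq
      simp only [Finset.mem_filter, Finset.mem_univ, true_and] at hp hq
      by_contra hpq
      have hB : ∀ p q, Matrix.toBilin' S (hS.eigenvectorBasis p) (hS.eigenvectorBasis q) =
          hS.eigenvalues q * if p = q then 1 else 0 := by
        intro p q
        rw [Matrix.toBilin'_apply', hS.mulVec_eigenvectorBasis, dotProduct_smul, smul_eq_mul]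
        congr 1
        rw [← orthonormal_iff_ite.1 hS.eigenvectorBasis.orthonormal p q]
        simp [PiLp.inner_apply, dotProduct, mul_comm]
      have := not_pos_of_orthogonal_of_le_sq (Matrix.toBilin' S) (dotLinear u)
        (fun v => by rw [dotLinear_apply]; exact toBilin'_le_sq h v)
        (x := hS.eigenvectorBasis p) (y := hS.eigenvectorBasis q)
        (by rw [hB, if_neg hpq, mul_zero]) (by rw [hB, if_neg (Ne.symm hpq), mul_zero])
        (by rw [hB, if_pos rfl, mul_one]; exact hq)
      rw [hB, if_pos rfl, mul_one] at this
      linarith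
    · rw [Nat.one_le_iff_ne_zero, ne_eq, Finset.card_eq_zero, Finset.filter_eq_empty_iff]
      intro hneg
      apply hne
      rw [← hS.eigenvalues_eq_zero_iff]
      have htr := hS.trace_eq_sum_eigenvalues
      simp only [Matrix.trace, diag_apply, hdiag, Finset.sum_const_zero] at htr
      have := (Finset.sum_eq_zero_iff_of_nonpos (f := hS.eigenvalues) (s := Finset.univ)
        fun i hi => not_lt.1 (hneg hi)).1 (by simpa using htr.symm)
      funext i
      exact this i (Finset.mem_univ i)
  refine ⟨hS, hrank, fun i => (hdiag i).ge, hpos, ?_⟩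
  have h1 := hS.rank_eq_card_non_zero_eigs
  rw [Fintype.card_subtype, hrank] at h1
  have h2 : (Finset.univ.filter fun i => hS.eigenvalues i ≠ 0) =
      (Finset.univ.filter fun i => 0 < hS.eigenvalues i) ∪
      (Finset.univ.filter fun i => hS.eigenvalues i < 0) := by
    ext i
    simp [lt_or_lt_iff_ne, eq_comm]
  rw [h2, Finset.card_union_of_disjoint, hpos] at h1
  · omega
  · rw [Finset.disjoint_filter]
    intro i _ h1 h2
    linarith

/-! ### Splitting off a hyperbolic plane; Gram vectors of the complement. -/

/-- The negative of the form `S` on the orthogonal complement of the hyperbolic plane spanned by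
the coordinate vectors `a` and `b`. -/
noncomputable def hyperbolicComplement {n : Type*} (S : Matrix n n ℝ) (a b : n) : Matrix n n ℝ :=
  Matrix.of fun i j => (S i b * S a j + S i a * S b j) / S a b - S i j

theorem hyperbolicComplement_mulVec {n : Type*} [Fintype n] (S : Matrix n n ℝ) (a b : n)
    (v : n → ℝ) (i : n) :
    (hyperbolicComplement S a b *ᵥ v) i =
      (S i b * (S *ᵥ v) a + S i a * (S *ᵥ v) b) / S a b - (S *ᵥ v) i := by
  simp only [mulVec, dotProduct, hyperbolicComplement, of_apply, sub_mul, Finset.sum_sub_distrib,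
    Finset.mul_sum, ← Finset.sum_add_distrib, Finset.sum_div]
  congr 1
  exact Finset.sum_congr rfl fun j _ => by ring

/-- The plane spanned by `a` and `b` already contains a positive vector, so a Lorentzian form is at
most `0` on its orthogonal complement. -/
theorem posSemidef_hyperbolicComplement {n m : Type*} [Fintype n] [DecidableEq n] [Fintype m]
    {S : Matrix n n ℝ} {u : n → ℝ} {w : m → n → ℝ}
    (h : ∀ i j, S i j = u i * u j - ∑ e, w e i * w e j) {a b : n} (ha : S a a = 0)
    (hb : S b b = 0) (hab : S a b ≠ 0) : (hyperbolicComplement S a b).PosSemidef := by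
  have hsymm : ∀ i j, S i j = S j i := fun i j => by simp only [h, mul_comm]
  refine .of_dotProduct_mulVec_nonneg ?_ fun v => ?_
  · ext i j
    simp only [conjTranspose_apply, star_trivial, hyperbolicComplement, of_apply]
    rw [hsymm j b, hsymm a i, hsymm j a, hsymm b i, hsymm j i]
    ring
  set B := Matrix.toBilin' S with hBdef
  have hBs : ∀ x i, B (Pi.single i 1) x = (S *ᵥ x) i := by
    intro x i
    rw [hBdef, Matrix.toBilin'_apply', single_one_dotProduct]
  have hsymmB : ∀ x y, B x y = B y x := by
    intro x y
    rw [hBdef, Matrix.toBilin'_apply', Matrix.toBilin'_apply', dotProduct_mulVec,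
      dotProduct_comm, ← mulVec_transpose]
    congr 2
    ext i j
    exact hsymm j i
  have hBs' : ∀ x i, B x (Pi.single i 1) = (S *ᵥ x) i := fun x i => by rw [hsymmB, hBs]
  have hS1 : ∀ i j, (S *ᵥ (Pi.single j 1)) i = S i j := by
    intro i j
    rw [mulVec_single_one]
    rfl
  set p := (S *ᵥ v) a
  set q := (S *ᵥ v) b
  -- `x` is the projection of `v` to the complement. The vector `z` of the plane has `B z z = 2 (S a
  -- b)²`, which is positive for either sign of `S a b`.
  set x : n → ℝ := v - (q / S a b) • Pi.single a 1 - (p / S a b) • Pi.single b 1 with hx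
  set z : n → ℝ := Pi.single a 1 + S a b • Pi.single b 1 with hz
  have hba : S b a = S a b := hsymm b a
  have hxz : B x z = 0 := by
    simp only [hx, hz, map_sub, map_add, map_smul, LinearMap.sub_apply, LinearMap.smul_apply,
      smul_eq_mul, hBs, hBs', hS1, ha, hb, hba]
    field_simp
    ring
  have hzz : 0 < B z z := by
    simp only [hz, map_add, map_smul, LinearMap.add_apply,
      LinearMap.smul_apply, smul_eq_mul, hBs, hS1, ha, hb, hba]
    have : 0 < S a b ^ 2 := by positivity
    nlinarith
  have hxx : B x x = - (star v ⬝ᵥ hyperbolicComplement S a b *ᵥ v) := by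
    have h1 : star v ⬝ᵥ hyperbolicComplement S a b *ᵥ v = 2 * (p * q) / S a b - B v v := by
      have h2 : hyperbolicComplement S a b *ᵥ v =
          (p / S a b) • (S *ᵥ Pi.single b 1) + (q / S a b) • (S *ᵥ Pi.single a 1) - S *ᵥ v := by
        ext i
        rw [hyperbolicComplement_mulVec]
        simp only [Pi.sub_apply, Pi.add_apply, Pi.smul_apply, hS1, smul_eq_mul]
        ring
      rw [star_trivial, h2, dotProduct_sub, dotProduct_add, dotProduct_smul, dotProduct_smul,
        ← Matrix.toBilin'_apply', ← Matrix.toBilin'_apply', ← Matrix.toBilin'_apply', ← hBdef,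
        hBs', hBs']
      change p / S a b * q + q / S a b * p - _ = _
      ring
    rw [h1]
    simp only [hx, map_sub, map_smul, LinearMap.sub_apply,
      LinearMap.smul_apply, smul_eq_mul, hBs, hBs', hS1, ha, hb, hba]
    change B v v - q / S a b * p - p / S a b * q - _ - _ = _
    change B v v - q / S a b * p - p / S a b * q - q / S a b * (p - _ - _) -
      p / S a b * (q - _ - _) = _
    field_simp
    ring
  have := not_pos_of_orthogonal_of_le_sq B (dotLinear u)
    (fun v => by rw [dotLinear_apply]; exact toBilin'_le_sq h v) hxz ((hsymmB z x).trans hxz) hzz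
  rw [hxx] at this
  linarith

/-- The kernel of the complement contains `ker S` together with the coordinate vectors `a` and `b`,
and these are independent modulo `ker S`. -/
theorem rank_hyperbolicComplement_add_two_le {n : Type*} [Fintype n] [DecidableEq n]
    {S : Matrix n n ℝ} {a b : n} (ha : S a a = 0) (hb : S b b = 0) (hab : S a b ≠ 0)
    (hba : S b a = S a b) : (hyperbolicComplement S a b).rank + 2 ≤ S.rank := by
  have hS1 : ∀ i j, (S *ᵥ (Pi.single j 1)) i = S i j := by
    intro i j
    rw [mulVec_single_one]
    rfl
  let g : (LinearMap.ker S.mulVecLin × (ℝ × ℝ)) →ₗ[ℝ] (n → ℝ) :=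
    (LinearMap.ker S.mulVecLin).subtype.coprod
      ((LinearMap.toSpanSingleton ℝ _ (Pi.single a 1)).coprod
        (LinearMap.toSpanSingleton ℝ _ (Pi.single b 1)))
  have hg : ∀ x, g x = (x.1 : n → ℝ) + (x.2.1 • Pi.single a 1 + x.2.2 • Pi.single b 1) := fun x => by
    simp [g]
  have hSg : ∀ x i, (S *ᵥ g x) i = x.2.1 * S i a + x.2.2 * S i b := by
    intro x i
    have : S *ᵥ x.1.1 = 0 := x.1.2
    rw [hg, mulVec_add, mulVec_add, mulVec_smul, mulVec_smul, this]
    simp only [Pi.add_apply, Pi.smul_apply, Pi.zero_apply, hS1, smul_eq_mul, zero_add]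
  have hmem : ∀ x, g x ∈ LinearMap.ker (hyperbolicComplement S a b).mulVecLin := by
    intro x
    rw [LinearMap.mem_ker, mulVecLin_apply]
    ext i
    rw [hyperbolicComplement_mulVec, hSg, hSg, hSg, ha, hb, hba]
    simp only [Pi.zero_apply]
    field_simp
    ring
  have hinj : Function.Injective (g.codRestrict _ hmem) := by
    rw [← LinearMap.ker_eq_bot, LinearMap.ker_codRestrict, LinearMap.ker_eq_bot']
    intro x hx
    have h1 := hSg x a
    have h2 := hSg x b
    rw [hx, mulVec_zero, ha, Pi.zero_apply, mul_zero, zero_add, eq_comm, mul_eq_zero] at h1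
    rw [hx, mulVec_zero, hb, hba, Pi.zero_apply, mul_zero, add_zero, eq_comm, mul_eq_zero] at h2
    have h1 := h1.resolve_right hab
    have h2 := h2.resolve_right hab
    rw [hg, h1, h2, zero_smul, zero_smul, add_zero, add_zero] at hx
    exact Prod.ext (Subtype.ext hx) (Prod.ext h2 h1)
  have h1 := LinearMap.finrank_le_finrank_of_injective hinj
  rw [Module.finrank_prod, Module.finrank_prod, Module.finrank_self] at h1
  have h2 := S.mulVecLin.finrank_range_add_finrank_ker
  have h3 := (hyperbolicComplement S a b).mulVecLin.finrank_range_add_finrank_ker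
  rw [Matrix.rank, Matrix.rank]
  omega

theorem _root_.Matrix.PosSemidef.exists_gram {n : Type*} [Fintype n] [DecidableEq n]
    {M : Matrix n n ℝ} (hM : M.PosSemidef) {k : ℕ} (hk : M.rank ≤ k) :
    ∃ Y : Fin k → n → ℝ, ∀ i j, M i j = ∑ e, Y e i * Y e j := by
  classical
  have hH := hM.isHermitian
  rw [hH.rank_eq_card_non_zero_eigs] at hk
  obtain ⟨f⟩ : Nonempty ({e // hH.eigenvalues e ≠ 0} ↪ Fin k) :=
    Function.Embedding.nonempty_of_card_le (by simpa using hk)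
  -- Rows of `Y` outside the range of `f` are padded with zeros.
  refine ⟨fun a i => Function.extend f
    (fun e => √(hH.eigenvalues e) * hH.eigenvectorBasis e.1 i) 0 a, fun i j => ?_⟩
  rw [hH.apply_eq_sum_eigenvalues i j, ← Finset.sum_subset (Finset.subset_univ
    (Finset.univ.map f))]
  · rw [Finset.sum_map]
    simp only [f.injective.extend_apply]
    rw [← Finset.sum_subtype (Finset.univ.filter fun e => hH.eigenvalues e ≠ 0) (by simp)
      (fun q => √(hH.eigenvalues q) * hH.eigenvectorBasis q i *
      (√(hH.eigenvalues q) * hH.eigenvectorBasis q j)), Finset.sum_filter]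
    refine Finset.sum_congr rfl fun q _ => ?_
    split_ifs with h0
    · have := Real.mul_self_sqrt (hM.eigenvalues_nonneg q)
      linear_combination (-hH.eigenvectorBasis q i * hH.eigenvectorBasis q j) * this
    · rw [not_not.1 h0]; simp
  · intro x _ hx
    dsimp only
    rw [Function.extend_apply', Pi.zero_apply, zero_mul]
    rintro ⟨y, rfl⟩
    exact hx (by simp)

/-- Vectors in `ℝ^k` can be rotated such that a given list of them becomes upper triangular. -/
theorem exists_triangular_gram {n : Type*} {k : ℕ} (Y : Fin k → n → ℝ) (s : Fin k → n) :
    ∃ Z : Fin k → n → ℝ, (∀ i j, ∑ e, Z e i * Z e j = ∑ e, Y e i * Y e j) ∧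
      ∀ p q, p < q → Z q (s p) = 0 := by
  let y : n → EuclideanSpace ℝ (Fin k) := fun i => WithLp.toLp 2 fun e => Y e i
  -- A QR decomposition; this is an orthonormal basis even if the vectors `y (s p)` are dependent.
  let b := InnerProductSpace.gramSchmidtOrthonormalBasis (𝕜 := ℝ) (ι := Fin k)
    (finrank_euclideanSpace (𝕜 := ℝ) (ι := Fin k)) (fun p => y (s p))
  refine ⟨fun e i => b.repr (y i) e, fun i j => ?_, fun p q hpq => ?_⟩
  · have h1 := b.repr.inner_map_map (y i) (y j)
    simp only [PiLp.inner_apply, y] at h1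
    simpa [mul_comm] using h1
  · exact InnerProductSpace.gramSchmidtOrthonormalBasis_inv_triangular' _ _ hpq

/-! ### Parametrisation by scaled null vectors. -/

/-- A labelling of `[n]` by `0, …, N + 2` such that all labels except possibly `0` occur. It
encodes a rank-two matroid with `N + 2` parts, whose loops have label `0`. -/
structure Labelling (n N : ℕ) where
  c : Fin n → ℕ
  rep : ℕ → Fin n
  c_le : ∀ i, c i ≤ N + 2
  c_rep : ∀ j, 1 ≤ j → j ≤ N + 2 → c (rep j) = j

namespace Labelling

variable {n N : ℕ} (ℓ : Labelling n N)

/-- The elements `i` and `j` have different non-zero labels. -/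
def Basis (i j : Fin n) : Prop := ℓ.c i ≠ 0 ∧ ℓ.c j ≠ 0 ∧ ℓ.c i ≠ ℓ.c j

/-- The parameters for null vectors in `ℝ^{1,k+1}`: one scale for each non-loop except one, and
the entries of an upper triangular `k × N` matrix, whose columns are points of `ℝ^k`. -/
abbrev ParamIndex (k : ℕ) : Type :=
  {i : Fin n // ℓ.c i ≠ 0 ∧ i ≠ ℓ.rep 1} ⊕ {q : Fin k × Fin N // q.1.val ≤ q.2.val}

variable {k : ℕ} {R : Type*} [CommRing R] (t : ℓ.ParamIndex k → R)

/-- The scale of the null vector with index `i`. -/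
def scale (i : Fin n) : R :=
  if h : ℓ.c i ≠ 0 ∧ i ≠ ℓ.rep 1 then t (.inl ⟨i, h⟩) else if i = ℓ.rep 1 then 1 else 0

/-- The coordinates of the point with label `m`. The point with label `1` is at infinity, and the
point with label `2` is the origin. -/
def point (e : Fin k) (m : ℕ) : R :=
  if h : 3 ≤ m ∧ m - 3 < N ∧ e.val ≤ m - 3 then t (.inr ⟨(e, ⟨m - 3, h.2.1⟩), h.2.2⟩) else 0

/-- The products of the unscaled null vectors. -/
def pairing (m m' : ℕ) : R :=
  if m = 1 then if m' = 1 then 0 else 1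
  else if m' = 1 then 1 else ∑ e, (ℓ.point t e m - ℓ.point t e m') ^ 2

/-- The products of the null vectors. -/
def entry (i j : Fin n) : R :=
  ℓ.scale t i * ℓ.scale t j * ℓ.pairing t (ℓ.c i) (ℓ.c j)

theorem map_scale {R' : Type*} [CommRing R'] (f : R →+* R') (i : Fin n) :
    f (ℓ.scale t i) = ℓ.scale (f ∘ t) i := by
  unfold scale
  split_ifs <;> simp

theorem map_point {R' : Type*} [CommRing R'] (f : R →+* R') (e : Fin k) (m : ℕ) :
    f (ℓ.point t e m) = ℓ.point (f ∘ t) e m := by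
  unfold point
  split_ifs <;> simp

/-- The same formula is used for real parameters, for polynomial variables and for their images in
the fraction field; this passes between the three. -/
theorem map_entry {R' : Type*} [CommRing R'] (f : R →+* R') (i j : Fin n) :
    f (ℓ.entry t i j) = ℓ.entry (f ∘ t) i j := by
  unfold entry pairing
  rw [map_mul, map_mul, map_scale, map_scale]
  congr 1
  split_ifs <;> simp [map_point]

theorem c_rep_one : ℓ.c (ℓ.rep 1) = 1 := ℓ.c_rep 1 le_rfl (by omega)

theorem c_rep_two : ℓ.c (ℓ.rep 2) = 2 := ℓ.c_rep 2 (by omega) (by omega)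

theorem rep_two_ne : ℓ.rep 2 ≠ ℓ.rep 1 := fun h => by
  have h1 := ℓ.c_rep_one
  rw [← h, c_rep_two] at h1
  omega

theorem scale_rep_one : ℓ.scale t (ℓ.rep 1) = 1 := by simp [scale]

theorem scale_of_ne {i : Fin n} (h : ℓ.c i ≠ 0 ∧ i ≠ ℓ.rep 1) :
    ℓ.scale t i = t (.inl ⟨i, h⟩) := dif_pos h

theorem scale_of_eq_zero {i : Fin n} (h : ℓ.c i = 0) : ℓ.scale t i = 0 := by
  have : i ≠ ℓ.rep 1 := by
    rintro rfl
    rw [c_rep_one] at h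
    omega
  simp [scale, h, this]

theorem point_two (e : Fin k) : ℓ.point t e 2 = 0 := by simp [point]

theorem point_add_three (e : Fin k) (m : Fin N) (h : e.val ≤ m.val) :
    ℓ.point t e (m + 3) = t (.inr ⟨(e, m), h⟩) := by
  have : 3 ≤ m.val + 3 ∧ m.val + 3 - 3 < N ∧ e.val ≤ m.val + 3 - 3 :=
    ⟨by omega, by omega, by omega⟩
  rw [point, dif_pos this]
  congr 3

theorem point_add_three_of_lt (e : Fin k) (m : Fin N) (h : m.val < e.val) :
    ℓ.point t e (m + 3) = 0 := by
  rw [point, dif_neg]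
  omega

theorem pairing_one_left {m : ℕ} (h : m ≠ 1) : ℓ.pairing t 1 m = 1 := by simp [pairing, h]

theorem pairing_one_right {m : ℕ} (h : m ≠ 1) : ℓ.pairing t m 1 = 1 := by simp [pairing, h]

theorem pairing_of_ne {m m' : ℕ} (h : m ≠ 1) (h' : m' ≠ 1) :
    ℓ.pairing t m m' = ∑ e, (ℓ.point t e m - ℓ.point t e m') ^ 2 := by simp [pairing, h, h']

theorem pairing_self (m : ℕ) : ℓ.pairing t m m = 0 := by
  unfold pairing
  split_ifs <;> simp

theorem scale_ne_zero [Nontrivial R] {t : ℓ.ParamIndex k → R} (ht : ∀ j, t j ≠ 0) {i : Fin n}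
    (hi : ℓ.c i ≠ 0) : ℓ.scale t i ≠ 0 := by
  by_cases h : i = ℓ.rep 1
  · rw [h, scale_rep_one]
    exact one_ne_zero
  · rw [scale_of_ne _ _ ⟨hi, h⟩]
    exact ht _

/-! ### Recovering the parameters from the matrix entries. -/

section Algebraic

variable {F : Type*} [Field F] [Algebra ℝ F] {t : ℓ.ParamIndex k → F} {K : IntermediateField ℝ F}

/-- Off label `1`, the scale is the entry against `rep 1`. For label `1` it is the entry against
`rep 2` divided by the scale of `rep 2`. -/
theorem scale_mem (ht : ∀ j, t j ≠ 0) (hK : ∀ i j, ℓ.entry t i j ∈ K) (i : Fin n) :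
    ℓ.scale t i ∈ K := by
  have h2 : ∀ i, ℓ.c i ≠ 1 → ℓ.scale t i ∈ K := by
    intro i hi
    have := hK (ℓ.rep 1) i
    rwa [entry, scale_rep_one, c_rep_one, pairing_one_left _ _ hi, one_mul, mul_one] at this
  by_cases h1 : ℓ.c i = 1
  · have h3 := hK i (ℓ.rep 2)
    have h4 := h2 (ℓ.rep 2) (by rw [c_rep_two]; omega)
    have h5 : ℓ.c (ℓ.rep 2) ≠ 0 ∧ ℓ.rep 2 ≠ ℓ.rep 1 := ⟨by rw [c_rep_two]; omega, ℓ.rep_two_ne⟩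
    have h6 : ℓ.scale t (ℓ.rep 2) ≠ 0 := by
      rw [scale_of_ne _ _ h5]
      exact ht _
    rw [entry, h1, c_rep_two, pairing_one_left _ _ (by omega), mul_one] at h3
    have := div_mem h3 h4
    rwa [mul_div_cancel_right₀ _ h6] at this
  · exact h2 i h1

/-- Dividing entries by scales gives squared distances; polarisation with the origin, label `2`,
turns these into inner products. -/
theorem sum_point_mul_mem (ht : ∀ j, t j ≠ 0) (hK : ∀ i j, ℓ.entry t i j ∈ K) {m m' : ℕ}
    (hm : 2 ≤ m) (hmN : m ≤ N + 2) (hm' : 2 ≤ m') (hmN' : m' ≤ N + 2) :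
    ∑ e, ℓ.point t e m * ℓ.point t e m' ∈ K := by
  have h1 : ∀ m m' : ℕ, 2 ≤ m → m ≤ N + 2 → 2 ≤ m' → m' ≤ N + 2 →
      ∑ e, (ℓ.point t e m - ℓ.point t e m') ^ 2 ∈ K := by
    intro m m' hm hmN hm' hmN'
    have h1 := hK (ℓ.rep m) (ℓ.rep m')
    have hc := ℓ.c_rep m (by omega) hmN
    have hc' := ℓ.c_rep m' (by omega) hmN'
    rw [entry, hc, hc', pairing_of_ne _ _ (by omega) (by omega)] at h1
    have h3 : ℓ.scale t (ℓ.rep m) * ℓ.scale t (ℓ.rep m') ≠ 0 :=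
      mul_ne_zero (ℓ.scale_ne_zero ht (by omega)) (ℓ.scale_ne_zero ht (by omega))
    have := div_mem h1 (mul_mem (ℓ.scale_mem ht hK (ℓ.rep m)) (ℓ.scale_mem ht hK (ℓ.rep m')))
    rwa [mul_div_cancel_left₀ _ h3] at this
  have h2 : ∀ m : ℕ, 2 ≤ m → m ≤ N + 2 → ∑ e, ℓ.point t e m ^ 2 ∈ K := by
    intro m hm hmN
    have := h1 m 2 hm hmN le_rfl (by omega)
    simpa [point_two] using this
  have h3 := sub_mem (add_mem (h2 m hm hmN) (h2 m' hm' hmN')) (h1 m m' hm hmN hm' hmN')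
  have h4 : ∑ e, ℓ.point t e m ^ 2 + ∑ e, ℓ.point t e m' ^ 2 -
      ∑ e, (ℓ.point t e m - ℓ.point t e m') ^ 2 = 2 * ∑ e, ℓ.point t e m * ℓ.point t e m' := by
    rw [← Finset.sum_add_distrib, ← Finset.sum_sub_distrib, Finset.mul_sum]
    exact Finset.sum_congr rfl fun e _ => by ring
  rw [h4] at h3
  have hchar : CharZero F := charZero_of_injective_algebraMap (algebraMap ℝ F).injective
  have := div_mem h3 (ofNat_mem K 2 : (2 : F) ∈ K)
  rwa [mul_div_cancel_left₀ _ two_ne_zero] at this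

/-- For the points this is a Cholesky decomposition, by induction on the row `e`. The inner product
of columns `e` and `m`, less the terms from earlier rows, is the diagonal entry of row `e` times its
entry in column `m`. The case `m = e` gives the diagonal entry by a square root, and division gives
the rest. -/
theorem param_mem (ht : ∀ j, t j ≠ 0) (hK : ∀ i j, ℓ.entry t i j ∈ K)
    (hsq : ∀ x, x ^ 2 ∈ K → x ∈ K) (j : ℓ.ParamIndex k) : t j ∈ K := by
  obtain ⟨i, hi⟩ | ⟨⟨e, m⟩, h⟩ := j
  · rw [← scale_of_ne _ t hi]
    exact ℓ.scale_mem ht hK i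
  suffices H : ∀ s : ℕ, ∀ (e : Fin k) (m : Fin N) (h : e.val ≤ m.val), e.val = s →
      t (.inr ⟨(e, m), h⟩) ∈ K from H e.val e m h rfl
  intro s
  induction s using Nat.strong_induction_on with
  | _ s ih =>
    rintro e m h rfl
    have key : ∀ m : Fin N, ∀ h : e.val ≤ m.val,
        t (.inr ⟨(e, ⟨e, h.trans_lt m.2⟩), le_rfl⟩) * t (.inr ⟨(e, m), h⟩) ∈ K := by
      intro m h
      have h1 := ℓ.sum_point_mul_mem ht hK (m := e + 3) (m' := m + 3) (by omega) (by omega)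
        (by omega) (by omega)
      rw [← Finset.add_sum_erase _ _ (Finset.mem_univ e)] at h1
      have h2 : ∑ x ∈ Finset.univ.erase e, ℓ.point t x (e + 3) * ℓ.point t x (m + 3) ∈ K := by
        refine sum_mem fun x hx => ?_
        have hxe : x.val ≠ e.val := fun h => (Finset.mem_erase.1 hx).1 (Fin.ext h)
        rcases lt_or_gt_of_ne hxe with hlt | hlt
        · have a1 := ih x hlt x ⟨e, h.trans_lt m.2⟩ hlt.le rfl
          have a2 := ih x hlt x m (hlt.le.trans h) rfl
          rw [← point_add_three _ t] at a1 a2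
          exact mul_mem a1 a2
        · have := ℓ.point_add_three_of_lt t x ⟨e, h.trans_lt m.2⟩ hlt
          simp only at this
          rw [this, zero_mul]
          exact zero_mem K
      have h3 := sub_mem h1 h2
      rw [add_sub_cancel_right] at h3
      rwa [ℓ.point_add_three t e m h,
        ℓ.point_add_three t e ⟨e, h.trans_lt m.2⟩ le_rfl] at h3
    have hd : t (.inr ⟨(e, ⟨e, h.trans_lt m.2⟩), le_rfl⟩) ∈ K := by
      apply hsq
      rw [pow_two]
      exact key ⟨e, h.trans_lt m.2⟩ le_rfl
    have := div_mem (key m h) hd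
    rwa [mul_div_cancel_left₀ _ (ht _)] at this

end Algebraic

/-! ### Every matrix of a stratum has parameters. -/

/-- Every matrix of products of null vectors with linear relations prescribed by the labelling
arises from some parameters. -/
theorem exists_entry_eq {m : Type*} [Fintype m] {S : Matrix (Fin n) (Fin n) ℝ} {u : Fin n → ℝ}
    {w : m → Fin n → ℝ} (h : ∀ i j, S i j = u i * u j - ∑ e, w e i * w e j)
    (hdiag : ∀ i, S i i = 0) (hrank : S.rank ≤ k + 2)
    (hS : ∀ i j, S i j ≠ 0 ↔ ℓ.Basis i j) :
    ∃ t : ℓ.ParamIndex k → ℝ, ∀ i j, S i j = ℓ.entry t i j := by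
  have hsymm : ∀ i j, S i j = S j i := fun i j => by simp only [h, mul_comm]
  set a := ℓ.rep 1 with ha
  set b := ℓ.rep 2 with hb
  have hca : ℓ.c a = 1 := ℓ.c_rep_one
  have hcb : ℓ.c b = 2 := ℓ.c_rep_two
  have hab : S a b ≠ 0 := (hS a b).2 ⟨by omega, by omega, by omega⟩
  have hr := rank_hyperbolicComplement_add_two_le (hdiag a) (hdiag b) hab (hsymm b a)
  obtain ⟨Y, hY⟩ := (posSemidef_hyperbolicComplement h (hdiag a) (hdiag b) hab).exists_gram
    (k := k) (by omega)
  obtain ⟨Z, hZ, hZtri⟩ := exists_triangular_gram Y fun p => ℓ.rep (p + 3)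
  have hSZ : ∀ i j, S i j = (S i b * S a j + S i a * S b j) / S a b - ∑ e, Z e i * Z e j := by
    intro i j
    rw [hZ, ← hY, hyperbolicComplement, of_apply]
    ring
  -- An unscaled vector off label `1` has product `1` with `a`, so its scale is the product with
  -- `a`. For label `1` the product with `b` is compared with that of `a`; in particular `lam a =
  -- 1`.
  let lam : Fin n → ℝ := fun i =>
    if ℓ.c i = 0 then 0 else if ℓ.c i = 1 then S i b / S a b else S i a
  -- The factor `√2` makes `|x_i - x_j|²`, rather than half of it, the product of unscaled vectors.
  let x : Fin k → Fin n → ℝ := fun e i => Z e i / (√2 * lam i)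
  have hlam : ∀ i, ℓ.c i ≠ 0 → lam i ≠ 0 := by
    intro i hi
    simp only [lam, if_neg hi]
    split_ifs with h1
    · exact div_ne_zero ((hS i b).2 ⟨hi, by omega, by omega⟩) hab
    · exact (hS i a).2 ⟨hi, by omega, by omega⟩
  have hxx : ∀ i j, ℓ.c i ≠ 0 → ℓ.c j ≠ 0 → ℓ.c i ≠ 1 → ℓ.c j ≠ 1 →
      S i j = lam i * lam j * ∑ e, (x e i - x e j) ^ 2 := by
    intro i j hi hj hi1 hj1
    have hli := hlam i hi
    have hlj := hlam j hj
    have hs : (√2 : ℝ) ^ 2 = 2 := Real.sq_sqrt (by norm_num)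
    have e1 : ∑ e, (x e i - x e j) ^ 2 = (∑ e, Z e i * Z e i) / (2 * lam i ^ 2) +
        (∑ e, Z e j * Z e j) / (2 * lam j ^ 2) - (∑ e, Z e i * Z e j) / (lam i * lam j) := by
      rw [Finset.sum_div, Finset.sum_div, Finset.sum_div, ← Finset.sum_add_distrib,
        ← Finset.sum_sub_distrib]
      refine Finset.sum_congr rfl fun e _ => ?_
      simp only [x]
      field_simp
      rw [hs]
      ring
    have hli' : lam i = S i a := by simp only [lam, if_neg hi, if_neg hi1]
    have hlj' : lam j = S j a := by simp only [lam, if_neg hj, if_neg hj1]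
    have z1 := hSZ i i
    have z2 := hSZ j j
    have z3 := hSZ i j
    rw [hdiag] at z1 z2
    rw [e1]
    have z1' : ∑ e, Z e i * Z e i = 2 * lam i * S i b / S a b := by
      rw [hli']
      linear_combination z1 + (S i b * hsymm a i + S i a * hsymm b i) / S a b
    have z2' : ∑ e, Z e j * Z e j = 2 * lam j * S j b / S a b := by
      rw [hlj']
      linear_combination z2 + (S j b * hsymm a j + S j a * hsymm b j) / S a b
    rw [z1', z2', z3, hsymm a j, hsymm b j, ← hli', ← hlj']
    field_simp
  -- Parallel elements have product `0`, so their points are at distance `0`.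
  have hxeq : ∀ i j, ℓ.c i ≠ 0 → ℓ.c i ≠ 1 → ℓ.c i = ℓ.c j → ∀ e, x e i = x e j := by
    intro i j hi hi1 hij e
    have h1 := hxx i j hi (by omega) hi1 (by omega)
    have h2 : S i j = 0 := by
      by_contra h0
      exact ((hS i j).1 h0).2.2 hij
    rw [h2, eq_comm, mul_eq_zero, or_iff_right (mul_ne_zero (hlam i hi) (hlam j (by omega))),
      Finset.sum_eq_zero_iff_of_nonneg fun _ _ => sq_nonneg _] at h1
    have := pow_eq_zero_iff (two_ne_zero) |>.1 (h1 e (Finset.mem_univ e))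
    linarith
  have hxb : ∀ e, x e b = 0 := by
    intro e
    have h1 := hSZ b b
    rw [hdiag] at h1
    have h2 : ∑ e, Z e b ^ 2 = 0 := by
      simp only [pow_two]
      linear_combination h1
    rw [Finset.sum_eq_zero_iff_of_nonneg fun _ _ => sq_nonneg _] at h2
    have := pow_eq_zero_iff (two_ne_zero) |>.1 (h2 e (Finset.mem_univ e))
    simp [x, this]
  let t : ℓ.ParamIndex k → ℝ :=
    Sum.elim (fun i => lam i) (fun q => x q.1.1 (ℓ.rep (q.1.2 + 3)))
  have hscale : ∀ i, ℓ.scale t i = lam i := by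
    intro i
    by_cases hi : ℓ.c i = 0
    · rw [scale_of_eq_zero _ _ hi]
      simp [lam, hi]
    · by_cases hia : i = a
      · rw [hia, ha, scale_rep_one, ← ha]
        simp [lam, hca, hab]
      · rw [scale_of_ne _ _ ⟨hi, hia⟩]
        rfl
  have hpoint : ∀ i e, ℓ.c i ≠ 0 → ℓ.c i ≠ 1 → ℓ.point t e (ℓ.c i) = x e i := by
    intro i e hi hi1
    by_cases hi2 : ℓ.c i = 2
    · rw [hi2, point_two, hxeq i b hi hi1 (by omega), hxb]
    have hle := ℓ.c_le i
    obtain ⟨m, hm⟩ : ∃ m : Fin N, ℓ.c i = m + 3 := ⟨⟨ℓ.c i - 3, by omega⟩, by simp only; omega⟩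
    have hcr := ℓ.c_rep (m + 3) (by omega) (by omega)
    rw [hxeq i (ℓ.rep (m + 3)) hi hi1 (by omega), hm]
    by_cases he : e.val ≤ m.val
    · rw [point_add_three _ _ _ _ he]
      rfl
    · rw [point_add_three_of_lt _ _ _ _ (by omega)]
      have := hZtri ⟨m, by omega⟩ e (by rw [Fin.lt_def]; simp only; omega)
      simp only at this
      simp [x, this]
  refine ⟨t, fun i j => ?_⟩
  rw [entry, hscale, hscale]
  by_cases hi : ℓ.c i = 0
  · have : S i j = 0 := by
      by_contra h0
      exact ((hS i j).1 h0).1 hi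
    simp [this, lam, hi]
  by_cases hj : ℓ.c j = 0
  · have : S i j = 0 := by
      by_contra h0
      exact ((hS i j).1 h0).2.1 hj
    simp [this, lam, hj]
  -- A vector parallel to `a` has no component in the complement, so only the hyperbolic part of
  -- `hSZ` remains.
  have hone : ∀ i j, ℓ.c i = 1 → ℓ.c j ≠ 0 → ℓ.c j ≠ 1 → S i j = lam i * lam j := by
    intro i j hi hj hj1
    have hia : S i a = 0 := by
      by_contra h0
      exact ((hS i a).1 h0).2.2 (by omega)
    have h1 := hSZ i i
    rw [hdiag, hsymm a i, hia] at h1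
    have h2 : ∑ e, Z e i ^ 2 = 0 := by
      simp only [pow_two]
      linear_combination h1
    rw [Finset.sum_eq_zero_iff_of_nonneg fun _ _ => sq_nonneg _] at h2
    have h3 : ∑ e, Z e i * Z e j = 0 := Finset.sum_eq_zero fun e _ => by
      rw [pow_eq_zero_iff (two_ne_zero) |>.1 (h2 e (Finset.mem_univ e)), zero_mul]
    rw [hSZ i j, h3, hia, hsymm a j]
    simp only [lam, hi, if_neg hj, if_neg hj1, if_true, one_ne_zero, if_false]
    ring
  by_cases hi1 : ℓ.c i = 1
  · by_cases hj1 : ℓ.c j = 1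
    · rw [hi1, hj1, pairing_self, mul_zero]
      by_contra h0
      exact ((hS i j).1 h0).2.2 (by omega)
    · rw [hone i j hi1 hj hj1, hi1, pairing_one_left _ _ hj1, mul_one]
  · by_cases hj1 : ℓ.c j = 1
    · rw [hsymm, hone j i hj1 hi hi1, hj1, pairing_one_right _ _ hi1, mul_one, mul_comm]
    · rw [hxx i j hi hj hi1 hj1, pairing_of_ne _ _ hi1 hj1]
      simp only [hpoint i _ hi hi1, hpoint j _ hj hj1]

end Labelling

/-! ### Rank, signature and signs of the parametrised matrices. -/

namespace Labelling

variable {n N : ℕ} (ℓ : Labelling n N) {k : ℕ} (t : ℓ.ParamIndex k → ℝ)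

theorem point_one (e : Fin k) : ℓ.point t e 1 = 0 := by simp [point]

/-- The null vectors, in coordinates `β, α, x_0, …, x_{k-1}` in which the form is
`α β' + α' β - 2 ∑ x_e x_e'`. -/
def nullVectors : Matrix (Fin 2 ⊕ Fin k) (Fin n) ℝ :=
  Matrix.of fun q i => ℓ.scale t i *
    Sum.elim ![if ℓ.c i = 1 then 1 else ∑ e, ℓ.point t e (ℓ.c i) ^ 2, if ℓ.c i = 1 then 0 else 1]
      (fun e => ℓ.point t e (ℓ.c i)) q

/-- The Gram matrix of the Lorentzian form. -/
def lorentzForm (k : ℕ) : Matrix (Fin 2 ⊕ Fin k) (Fin 2 ⊕ Fin k) ℝ :=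
  fromBlocks !![0, 1; 1, 0] 0 0 (diagonal fun _ => -2)

theorem det_lorentzForm_ne_zero (k : ℕ) : (lorentzForm k).det ≠ 0 := by
  rw [lorentzForm, det_fromBlocks_zero₂₁, det_fin_two_of, det_diagonal]
  simp

/-- A finite point `x` lifts to the null vector `(|x|², 1, x)`, infinity to `(1, 0, 0)`, and the
form of two finite lifts is `|x|² + |y|² - 2 x·y`. -/
theorem entry_eq_nullVectors (i j : Fin n) :
    ℓ.entry t i j = ℓ.nullVectors t (.inl 0) i * ℓ.nullVectors t (.inl 1) j +
      ℓ.nullVectors t (.inl 1) i * ℓ.nullVectors t (.inl 0) j -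
      2 * ∑ e, ℓ.nullVectors t (.inr e) i * ℓ.nullVectors t (.inr e) j := by
  have h : ∀ e, ℓ.nullVectors t (.inr e) i * ℓ.nullVectors t (.inr e) j =
      ℓ.scale t i * ℓ.scale t j * (ℓ.point t e (ℓ.c i) * ℓ.point t e (ℓ.c j)) := fun e => by
    simp only [nullVectors, of_apply, Sum.elim_inr]
    ring
  simp only [h, ← Finset.mul_sum]
  simp only [entry, nullVectors, of_apply, Sum.elim_inl, cons_val_zero, cons_val_one]
  by_cases hi : ℓ.c i = 1 <;> by_cases hj : ℓ.c j = 1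
  · simp [pairing, hi, hj, point_one]
  · simp [pairing, hi, hj, point_one]
  · simp [pairing, hi, hj, point_one]
  · have : ∑ e, (ℓ.point t e (ℓ.c i) - ℓ.point t e (ℓ.c j)) ^ 2 =
        ∑ e, ℓ.point t e (ℓ.c i) ^ 2 + ∑ e, ℓ.point t e (ℓ.c j) ^ 2 -
        2 * ∑ e, ℓ.point t e (ℓ.c i) * ℓ.point t e (ℓ.c j) := by
      rw [Finset.mul_sum, ← Finset.sum_add_distrib, ← Finset.sum_sub_distrib]
      exact Finset.sum_congr rfl fun e _ => by ring
    rw [pairing_of_ne _ _ hi hj, this]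
    simp only [if_neg hi, if_neg hj]
    ring

theorem of_entry_eq_mul :
    Matrix.of (ℓ.entry t) = (ℓ.nullVectors t)ᵀ * (lorentzForm k * ℓ.nullVectors t) := by
  ext i j
  rw [of_apply, entry_eq_nullVectors, Matrix.mul_apply, Fintype.sum_sum_type, Fin.sum_univ_two]
  have h0 : (lorentzForm k * ℓ.nullVectors t) (.inl 0) j = ℓ.nullVectors t (.inl 1) j := by
    rw [Matrix.mul_apply, Fintype.sum_sum_type, Fin.sum_univ_two]
    simp [lorentzForm]
  have h1 : (lorentzForm k * ℓ.nullVectors t) (.inl 1) j = ℓ.nullVectors t (.inl 0) j := by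
    rw [Matrix.mul_apply, Fintype.sum_sum_type, Fin.sum_univ_two]
    simp [lorentzForm]
  have h2 : ∀ e, (lorentzForm k * ℓ.nullVectors t) (.inr e) j =
      -2 * ℓ.nullVectors t (.inr e) j := by
    intro e
    rw [Matrix.mul_apply, Fintype.sum_sum_type, Fin.sum_univ_two]
    simp [lorentzForm, diagonal_apply]
  simp only [h0, h1, h2, transpose_apply]
  rw [sub_eq_add_neg, Finset.mul_sum, ← Finset.sum_neg_distrib]
  congr 1
  exact Finset.sum_congr rfl fun e _ => by ring

/-- Indices of null vectors that form a basis. -/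
def basisIndex (k : ℕ) : Fin 2 ⊕ Fin k → Fin n :=
  Sum.elim ![ℓ.rep 1, ℓ.rep 2] fun e => ℓ.rep (e + 3)

/-- Infinity and the origin span the two light-cone coordinates. The next `k` points form an upper
triangular block with non-zero parameters on its diagonal, up to scales. -/
theorem det_nullVectors_ne_zero (hkN : k ≤ N) {t : ℓ.ParamIndex k → ℝ} (ht : ∀ j, t j ≠ 0) :
    ((ℓ.nullVectors t).submatrix id (ℓ.basisIndex k)).det ≠ 0 := by
  have hc : ∀ e : Fin k, ℓ.c (ℓ.rep (e + 3)) = e + 3 := fun e => ℓ.c_rep _ (by omega) (by omega)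
  rw [← fromBlocks_toBlocks ((ℓ.nullVectors t).submatrix id (ℓ.basisIndex k))]
  have h21 : ((ℓ.nullVectors t).submatrix id (ℓ.basisIndex k)).toBlocks₂₁ = 0 := by
    ext e q
    fin_cases q <;>
      simp [toBlocks₂₁, basisIndex, nullVectors, c_rep_one, c_rep_two, point_one, point_two]
  rw [h21, det_fromBlocks_zero₂₁]
  refine mul_ne_zero ?_ ?_
  · rw [det_fin_two]
    simp only [toBlocks₁₁, basisIndex, nullVectors, c_rep_one, c_rep_two, point_two, of_apply,
      submatrix_apply, Sum.elim_inl, cons_val_zero, cons_val_one, id, scale_rep_one]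
    simp only [if_true, mul_one, mul_zero, sub_zero, one_mul]
    rw [if_neg (by omega)]
    simpa using ℓ.scale_ne_zero ht (by rw [c_rep_two]; omega)
  · have hT : ∀ e e' : Fin k, ((ℓ.nullVectors t).submatrix id (ℓ.basisIndex k)).toBlocks₂₂ e e' =
        ℓ.scale t (ℓ.rep (e' + 3)) * ℓ.point t e (e' + 3) := by
      intro e e'
      simp [toBlocks₂₂, basisIndex, nullVectors, hc]
    rw [det_of_isUpperTriangular]
    · refine Finset.prod_ne_zero_iff.2 fun e _ => ?_
      rw [hT]
      refine mul_ne_zero (ℓ.scale_ne_zero ht (by rw [hc]; omega)) ?_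
      have := ℓ.point_add_three t e ⟨e, by omega⟩ le_rfl
      simp only at this
      rw [this]
      exact ht _
    · intro e e' hee'
      rw [hT]
      have := ℓ.point_add_three_of_lt t e ⟨e', by omega⟩ hee'
      simp only at this
      rw [this, mul_zero]

theorem rank_entry (hkN : k ≤ N) {t : ℓ.ParamIndex k → ℝ} (ht : ∀ j, t j ≠ 0) :
    (Matrix.of (ℓ.entry t)).rank = k + 2 := by
  apply le_antisymm
  · rw [of_entry_eq_mul]
    refine (rank_mul_le_left _ _).trans ((rank_le_card_width _).trans ?_)
    simp [add_comm]
  · have h1 : (Matrix.of (ℓ.entry t)).submatrix (ℓ.basisIndex k) (ℓ.basisIndex k) =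
        ((ℓ.nullVectors t).submatrix id (ℓ.basisIndex k))ᵀ *
        (lorentzForm k * ((ℓ.nullVectors t).submatrix id (ℓ.basisIndex k))) := by
      rw [of_entry_eq_mul, submatrix_mul _ _ _ id _ Function.bijective_id,
        submatrix_mul _ _ id id _ Function.bijective_id, submatrix_id_id, transpose_submatrix]
    have h2 : ((Matrix.of (ℓ.entry t)).submatrix (ℓ.basisIndex k) (ℓ.basisIndex k)).rank =
        k + 2 := by
      rw [rank_of_isUnit]
      · simp [add_comm]
      · rw [isUnit_iff_isUnit_det, isUnit_iff_ne_zero, h1, det_mul, det_mul, det_transpose]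
        have := ℓ.det_nullVectors_ne_zero hkN ht
        exact mul_ne_zero this (mul_ne_zero (det_lorentzForm_ne_zero k) this)
    rw [← h2]
    exact rank_submatrix_le _ _ _

theorem entry_self (i : Fin n) : ℓ.entry t i i = 0 := by
  rw [entry, pairing_self, mul_zero]

theorem isMandelstam_entry (hkN : k ≤ N) {t : ℓ.ParamIndex k → ℝ} (ht : ∀ j, t j ≠ 0) :
    IsMandelstam (Matrix.of (ℓ.entry t)) (k + 2) := by
  -- The substitution `(β ± α) / √2` turns `α β' + α' β` into a difference of squares.
  refine isMandelstam_of_lorentz_gram (m := Option (Fin k))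
    (u := fun i => (ℓ.nullVectors t (.inl 0) i + ℓ.nullVectors t (.inl 1) i) / √2)
    (w := fun o i => o.elim ((ℓ.nullVectors t (.inl 0) i - ℓ.nullVectors t (.inl 1) i) / √2)
      fun e => √2 * ℓ.nullVectors t (.inr e) i) (by omega) (fun i j => ?_) (ℓ.rank_entry hkN ht)
    (fun i => ℓ.entry_self t i)
  rw [of_apply, entry_eq_nullVectors, Fintype.sum_option]
  have hs : (√2 : ℝ) ^ 2 = 2 := Real.sq_sqrt (by norm_num)
  have h : ∀ e, √2 * ℓ.nullVectors t (.inr e) i * (√2 * ℓ.nullVectors t (.inr e) j) =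
      2 * (ℓ.nullVectors t (.inr e) i * ℓ.nullVectors t (.inr e) j) := fun e => by
    linear_combination ℓ.nullVectors t (.inr e) i * ℓ.nullVectors t (.inr e) j * hs
  simp only [Option.elim, h, ← Finset.mul_sum]
  field_simp
  rw [hs]
  ring

theorem entry_of_not_basis {i j : Fin n} (h : ¬ ℓ.Basis i j) : ℓ.entry t i j = 0 := by
  by_cases hi : ℓ.c i = 0
  · rw [entry, scale_of_eq_zero _ _ hi, zero_mul, zero_mul]
  by_cases hj : ℓ.c j = 0
  · rw [entry, scale_of_eq_zero _ _ hj, mul_zero, zero_mul]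
  have : ℓ.c i = ℓ.c j := by
    by_contra hij
    exact h ⟨hi, hj, hij⟩
  rw [entry, this, pairing_self, mul_zero]

/-- A box of parameters for which the products of the null vectors have signs given by `σ`. -/
def box (σ : Fin n → ℤˣ) : ℓ.ParamIndex k → Set ℝ :=
  Sum.elim (fun i => {x | 0 < ((σ i * σ (ℓ.rep 1) : ℤˣ) : ℤ) * x})
    (fun q => Set.Ioo ((q.1.2 : ℝ) + 1) (q.1.2 + 2))

theorem box_infinite (σ : Fin n → ℤˣ) (j : ℓ.ParamIndex k) : (ℓ.box σ j).Infinite := by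
  obtain i | q := j
  · rcases Int.units_eq_one_or (σ i * σ (ℓ.rep 1)) with h | h
    · have : ℓ.box (k := k) σ (.inl i) = Set.Ioi 0 := by
        ext x
        simp only [box, Sum.elim_inl, h]
        simp
      rw [this]
      exact Set.Ioi_infinite 0
    · have : ℓ.box (k := k) σ (.inl i) = Set.Iio 0 := by
        ext x
        simp only [box, Sum.elim_inl, h]
        simp
      rw [this]
      exact Set.Iio_infinite 0
  · exact Set.Ioo_infinite (by linarith)

variable {t} {σ : Fin n → ℤˣ}

theorem ne_zero_of_mem_box (ht : ∀ j, t j ∈ ℓ.box σ j) (j : ℓ.ParamIndex k) : t j ≠ 0 := by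
  have h := ht j
  obtain i | q := j
  · intro h0
    rw [h0] at h
    simp [box] at h
  · have h1 : ((q.1.2 : ℕ) : ℝ) + 1 < t (.inr q) := h.1
    have : (0 : ℝ) ≤ (q.1.2 : ℕ) := Nat.cast_nonneg _
    linarith

theorem scale_pos_of_mem_box (ht : ∀ j, t j ∈ ℓ.box σ j) {i : Fin n} (hi : ℓ.c i ≠ 0) :
    0 < (((σ i * σ (ℓ.rep 1) : ℤˣ) : ℤ) : ℝ) * ℓ.scale t i := by
  by_cases h : i = ℓ.rep 1
  · rw [h, scale_rep_one, ← pow_two, Int.units_sq]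
    simp
  · rw [scale_of_ne _ _ ⟨hi, h⟩]
    exact ht (.inl ⟨i, ⟨hi, h⟩⟩)

/-- First coordinates separate the finite points: it is `0` for label `2` and lies in the interval
`(m - 2, m - 1)` for label `m ≥ 3`. A first coordinate exists by `hk`, unless infinity and the
origin are the only points. -/
theorem pairing_pos_of_mem_box (hk : 0 < N → 0 < k) (ht : ∀ j, t j ∈ ℓ.box σ j) {m m' : ℕ}
    (hm : 1 ≤ m) (hmN : m ≤ N + 2) (hm' : 1 ≤ m') (hmN' : m' ≤ N + 2) (hmm' : m ≠ m') :
    0 < ℓ.pairing t m m' := by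
  by_cases h1 : m = 1
  · rw [h1, pairing_one_left _ _ (by omega)]
    exact one_pos
  by_cases h1' : m' = 1
  · rw [h1', pairing_one_right _ _ h1]
    exact one_pos
  rw [pairing_of_ne _ _ h1 h1']
  have hk0 : 0 < k := hk (by omega)
  have hval : ∀ m, 2 ≤ m → m ≤ N + 2 → ℓ.point t ⟨0, hk0⟩ m = 0 ∧ m = 2 ∨
      (m : ℝ) - 2 < ℓ.point t ⟨0, hk0⟩ m ∧ ℓ.point t ⟨0, hk0⟩ m < (m : ℝ) - 1 ∧ 3 ≤ m := by
    intro m hm hmN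
    by_cases h2 : m = 2
    · exact .inl ⟨by rw [h2, point_two], h2⟩
    · obtain ⟨q, rfl⟩ : ∃ q, m = q + 3 := ⟨m - 3, by omega⟩
      have := ℓ.point_add_three t ⟨0, hk0⟩ ⟨q, by omega⟩ (Nat.zero_le _)
      simp only at this
      rw [this]
      have h3 := ht (.inr ⟨(⟨0, hk0⟩, ⟨q, by omega⟩), Nat.zero_le _⟩)
      have h4 := h3.1
      have h5 := h3.2
      simp only at h4 h5
      refine .inr ⟨?_, ?_, by omega⟩ <;> push_cast <;> linarith
  have hne : ℓ.point t ⟨0, hk0⟩ m - ℓ.point t ⟨0, hk0⟩ m' ≠ 0 := by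
    intro h0
    rcases hval m (by omega) hmN with ⟨e1, e2⟩ | ⟨e1, e2, e3⟩ <;>
    rcases hval m' (by omega) hmN' with ⟨f1, f2⟩ | ⟨f1, f2, f3⟩
    · omega
    · have : (3 : ℝ) ≤ m' := by exact_mod_cast f3
      linarith
    · have : (3 : ℝ) ≤ m := by exact_mod_cast e3
      linarith
    · rcases lt_or_gt_of_ne hmm' with hlt | hlt
      · have : (m : ℝ) + 1 ≤ m' := by exact_mod_cast hlt
        linarith
      · have : (m' : ℝ) + 1 ≤ m := by exact_mod_cast hlt
        linarith
  exact (pow_pos (abs_pos.2 hne) 2).trans_le ((sq_abs _).le.trans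
    (Finset.single_le_sum (f := fun e => (ℓ.point t e m - ℓ.point t e m') ^ 2)
      (fun _ _ => sq_nonneg _) (Finset.mem_univ (⟨0, hk0⟩ : Fin k))))

theorem sign_entry_of_mem_box (hk : 0 < N → 0 < k) (ht : ∀ j, t j ∈ ℓ.box σ j) {i j : Fin n}
    (h : ℓ.Basis i j) :
    SignType.sign (ℓ.entry t i j) = SignType.sign ((σ i * σ j : ℤˣ) : ℤ) := by
  have hp := ℓ.pairing_pos_of_mem_box hk ht (Nat.one_le_iff_ne_zero.2 h.1) (ℓ.c_le i)
    (Nat.one_le_iff_ne_zero.2 h.2.1) (ℓ.c_le j) h.2.2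
  have h1 := mul_pos (mul_pos (ℓ.scale_pos_of_mem_box ht h.1) (ℓ.scale_pos_of_mem_box ht h.2.1)) hp
  have h2 : 0 < (((σ i * σ j : ℤˣ) : ℤ) : ℝ) * ℓ.entry t i j := by
    have h3 : σ i * σ j = (σ i * σ (ℓ.rep 1)) * (σ j * σ (ℓ.rep 1)) := by
      rw [mul_mul_mul_comm, ← pow_two (σ (ℓ.rep 1)), Int.units_sq, mul_one]
    rw [h3, entry]
    push_cast at h1 ⊢
    linarith
  rcases Int.units_eq_one_or (σ i * σ j) with h4 | h4
  · rw [h4] at h2 ⊢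
    simp only [Units.val_one, Int.cast_one, one_mul] at h2
    rw [sign_pos h2]
    rfl
  · rw [h4] at h2 ⊢
    simp only [Units.val_neg, Units.val_one, Int.cast_neg, Int.cast_one, neg_mul, one_mul,
      Left.neg_pos_iff] at h2
    rw [sign_neg h2]
    rfl

theorem card_paramIndex (hkN : k ≤ N) :
    (Fintype.card (ℓ.ParamIndex k) : ℤ) = (Finset.univ.filter fun i => ℓ.c i ≠ 0).card - 1 +
      k * N - (k.choose 2 : ℤ) := by
  classical
  rw [Fintype.card_sum, Fintype.card_subtype, Fintype.card_subtype]
  have h1 : (Finset.univ.filter fun i => ℓ.c i ≠ 0 ∧ i ≠ ℓ.rep 1) =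
      (Finset.univ.filter fun i => ℓ.c i ≠ 0).erase (ℓ.rep 1) := by
    ext i
    simp [and_comm]
  have hmem : ℓ.rep 1 ∈ Finset.univ.filter fun i => ℓ.c i ≠ 0 := by simp [c_rep_one]
  have hpos := Finset.card_pos.2 ⟨_, hmem⟩
  rw [h1, Finset.card_erase_of_mem hmem]
  -- Row `e` of the triangular array has `N - e` entries; the subtraction does not truncate, as `e <
  -- k ≤ N`.
  have h2 : (Finset.univ.filter fun q : Fin k × Fin N => q.1.val ≤ q.2.val).card =
      ∑ e : Fin k, (N - e.val) := by
    rw [Finset.card_filter, Fintype.sum_prod_type]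
    refine Finset.sum_congr rfl fun e _ => ?_
    rw [← Finset.card_filter]
    have : (Finset.univ.filter fun m : Fin N => e.val ≤ m.val) =
        Finset.Ici (⟨e, by omega⟩ : Fin N) := by
      ext m
      simp [Fin.le_def]
    rw [this, Fin.card_Ici]
  have h3 : ∀ k ≤ N, ((∑ e : Fin k, (N - e.val) : ℕ) : ℤ) = k * N - (k.choose 2 : ℤ) := by
    intro k
    induction k with
    | zero => simp
    | succ k ih =>
      intro hk
      rw [Fin.sum_univ_castSucc, Nat.choose_succ_succ' k 1]
      push_cast [Nat.choose_one_right]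
      have := ih (by omega)
      push_cast at this
      simp only [Fin.val_castSucc]
      rw [this]
      push_cast [Nat.cast_sub (show k ≤ N by omega)]
      ring
  rw [h2]
  push_cast [Nat.cast_sub (show 1 ≤ _ from hpos)]
  have := h3 k hkN
  push_cast at this
  rw [this]
  ring

end Labelling

/-! ### Rank-two matroids and their bases. -/

namespace RankTwoMatroid

variable {n : ℕ}

theorem isBasis_iff {P : RankTwoMatroid n} {i j : Fin n} :
    P.IsBasis i j ↔ i ∈ P.support ∧ j ∈ P.support ∧ P.partition.part i ≠ P.partition.part j := by
  constructor
  · intro h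
    refine ⟨h.mem_support.1, h.mem_support.2, ?_⟩
    obtain ⟨A, hA, B, hB, hAB, hi, hj⟩ := h
    rwa [P.partition.part_eq_of_mem hA hi, P.partition.part_eq_of_mem hB hj]
  · rintro ⟨hi, hj, h⟩
    exact ⟨_, P.partition.part_mem.2 hi, _, P.partition.part_mem.2 hj, h,
      P.partition.mem_part hi, P.partition.mem_part hj⟩

theorem exists_part_ne (P : RankTwoMatroid n) (A : Finset (Fin n)) :
    ∃ j ∈ P.support, P.partition.part j ≠ A := by
  obtain ⟨B, hB, hBA⟩ := Finset.exists_mem_ne P.two_le_card A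
  obtain ⟨j, hj⟩ := P.partition.nonempty_of_mem_parts hB
  exact ⟨j, P.partition.le hB hj, by rwa [P.partition.part_eq_of_mem hB hj]⟩

theorem mem_support_iff {P : RankTwoMatroid n} {i : Fin n} :
    i ∈ P.support ↔ ∃ j, P.IsBasis i j := by
  constructor
  · intro hi
    obtain ⟨j, hj, hne⟩ := P.exists_part_ne (P.partition.part i)
    exact ⟨j, isBasis_iff.2 ⟨hi, hj, hne.symm⟩⟩
  · rintro ⟨j, h⟩
    exact h.mem_support.1

theorem mem_part_iff {P : RankTwoMatroid n} {i j : Fin n} (hi : i ∈ P.support) :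
    j ∈ P.partition.part i ↔ j ∈ P.support ∧ ¬ P.IsBasis i j := by
  constructor
  · intro hj
    have hjs := P.partition.part_subset i hj
    refine ⟨hjs, fun h => (isBasis_iff.1 h).2.2 ?_⟩
    exact ((P.partition.mem_part_iff_part_eq_part hjs hi).1 hj).symm
  · rintro ⟨hj, h⟩
    rw [P.partition.mem_part_iff_part_eq_part hj hi]
    by_contra hne
    exact h (isBasis_iff.2 ⟨hi, hj, Ne.symm hne⟩)

theorem parts_subset_of_isBasis {P P' : RankTwoMatroid n}
    (h : ∀ i j, P.IsBasis i j ↔ P'.IsBasis i j) :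
    P.partition.parts ⊆ P'.partition.parts := by
  intro A hA
  obtain ⟨i, hi⟩ := P.partition.nonempty_of_mem_parts hA
  have his := P.partition.le hA hi
  have hs : ∀ j, j ∈ P.support ↔ j ∈ P'.support := fun j => by
    rw [mem_support_iff, mem_support_iff]
    exact exists_congr fun k => h j k
  have : A = P'.partition.part i := by
    rw [← P.partition.part_eq_of_mem hA hi]
    ext j
    rw [mem_part_iff his, mem_part_iff ((hs i).1 his), hs, h]
  rw [this, P'.partition.part_mem]
  exact (hs i).1 his

/-- A rank-two matroid is determined by its bases. -/
theorem ext_isBasis {P P' : RankTwoMatroid n} (h : ∀ i j, P.IsBasis i j ↔ P'.IsBasis i j) :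
    P = P' := by
  have h1 := (parts_subset_of_isBasis h).antisymm
    (parts_subset_of_isBasis fun i j => (h i j).symm)
  have hs : P.support = P'.support := by
    ext i
    rw [mem_support_iff, mem_support_iff]
    exact exists_congr fun k => h i k
  obtain ⟨s, p, hp⟩ := P
  obtain ⟨s', p', hp'⟩ := P'
  obtain rfl : s = s' := hs
  obtain rfl : p = p' := Finpartition.ext h1
  rfl

/-- The rank-two matroid whose parts are the fibres of `g` on `s`. -/
theorem exists_isBasis_iff {α : Type*} (s : Finset (Fin n)) (g : Fin n → α)
    (h : ∃ i ∈ s, ∃ j ∈ s, g i ≠ g j) :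
    ∃ P : RankTwoMatroid n, P.support = s ∧
      ∀ i j, P.IsBasis i j ↔ i ∈ s ∧ j ∈ s ∧ g i ≠ g j := by
  classical
  let F : Fin n → Finset (Fin n) := fun i => s.filter fun j => g j = g i
  have hF : ∀ i j, i ∈ s → (F i = F j ↔ g i = g j) := by
    intro i j hi
    constructor
    · intro h
      have : i ∈ F j := h ▸ Finset.mem_filter.2 ⟨hi, rfl⟩
      exact (Finset.mem_filter.1 this).2
    · intro h
      simp only [F, h]
  have hmem : ∀ i ∈ s, i ∈ F i := fun i hi => Finset.mem_filter.2 ⟨hi, rfl⟩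
  let p : Finpartition s := Finpartition.ofExistsUnique (s.image F)
    (by
      intro A hA
      obtain ⟨i, -, rfl⟩ := Finset.mem_image.1 hA
      exact Finset.filter_subset _ _)
    (by
      intro i hi
      refine ⟨F i, ⟨Finset.mem_image_of_mem _ hi, hmem i hi⟩, ?_⟩
      rintro A ⟨hA, hiA⟩
      obtain ⟨j, -, rfl⟩ := Finset.mem_image.1 hA
      exact ((hF i j hi).2 (Finset.mem_filter.1 hiA).2).symm)
    (by
      intro hA
      obtain ⟨i, hi, hi'⟩ := Finset.mem_image.1 hA
      have := hmem i hi
      rw [hi'] at this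
      simp at this)
  have hpart : ∀ i ∈ s, p.part i = F i := fun i hi =>
    p.part_eq_of_mem (Finset.mem_image_of_mem _ hi) (hmem i hi)
  refine ⟨⟨s, p, ?_⟩, rfl, fun i j => ?_⟩
  · obtain ⟨i, hi, j, hj, hij⟩ := h
    exact Finset.one_lt_card.2 ⟨F i, Finset.mem_image_of_mem _ hi, F j,
      Finset.mem_image_of_mem _ hj, fun h => hij ((hF i j hi).1 h)⟩
  · rw [isBasis_iff]
    refine and_congr_right fun hi => and_congr_right fun hj => ?_
    simp only [hpart i hi, hpart j hj, ne_eq, hF i j hi]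

theorem exists_labelling (P : RankTwoMatroid n) {N : ℕ} (hN : P.numParts = N + 2) :
    ∃ ℓ : Labelling n N, (∀ i, ℓ.c i ≠ 0 ↔ i ∈ P.support) ∧
      ∀ i j, ℓ.Basis i j ↔ P.IsBasis i j := by
  classical
  have e : P.partition.parts ≃ Fin (N + 2) := Finset.equivFinOfCardEq hN
  let c : Fin n → ℕ := fun i =>
    if h : i ∈ P.support then e ⟨P.partition.part i, P.partition.part_mem.2 h⟩ + 1 else 0
  have hc : ∀ i, c i ≠ 0 ↔ i ∈ P.support := by
    intro i
    by_cases h : i ∈ P.support <;> simp [c, h]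
  have hrep : ∀ m : Fin (N + 2), ∃ i, c i = m + 1 := by
    intro m
    obtain ⟨i, hi⟩ := P.partition.nonempty_of_mem_parts (e.symm m).2
    have his := P.partition.le (e.symm m).2 hi
    refine ⟨i, ?_⟩
    have : (⟨P.partition.part i, P.partition.part_mem.2 his⟩ : P.partition.parts) = e.symm m :=
      Subtype.ext (P.partition.part_eq_of_mem (e.symm m).2 hi)
    simp only [c, dif_pos his, this, Equiv.apply_symm_apply]
  choose rep hrep using hrep
  let ℓ : Labelling n N :=
    { c := c
      -- Parts are numbered from `0` but labels from `1`; the value outside the range of labels is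
      -- arbitrary.
      rep := fun j => if h : 1 ≤ j ∧ j ≤ N + 2 then rep ⟨j - 1, by omega⟩ else rep 0
      c_le := fun i => by
        simp only [c]
        split_ifs
        · omega
        · omega
      c_rep := fun j h1 h2 => by
        rw [dif_pos ⟨h1, h2⟩, hrep]
        simp only
        omega }
  refine ⟨ℓ, hc, fun i j => ?_⟩
  rw [isBasis_iff]
  change c i ≠ 0 ∧ c j ≠ 0 ∧ c i ≠ c j ↔ _
  rw [hc, hc]
  refine and_congr_right fun hi => and_congr_right fun hj => ?_
  simp only [c, dif_pos hi, dif_pos hj, ne_eq, add_left_inj, Fin.val_inj,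
    EmbeddingLike.apply_eq_iff_eq, Subtype.mk.injEq]

theorem card_support_add_numLoops (P : RankTwoMatroid n) :
    P.support.card + P.numLoops = n := by
  have := Finset.card_sdiff_add_card_eq_card (Finset.subset_univ P.support)
  rw [Finset.card_fin] at this
  rw [numLoops, loops]
  omega

end RankTwoMatroid

/-! ### The strata: disjointness, covering and bounds on the rank. -/

theorem sign_units_injective {a b : ℤˣ}
    (h : SignType.sign (a : ℤ) = SignType.sign (b : ℤ)) : a = b := by
  rcases Int.units_eq_one_or a with rfl | rfl <;> rcases Int.units_eq_one_or b with rfl | rfl <;>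
    first | rfl | exact absurd h (by decide)

theorem sign_units_ne_zero (a : ℤˣ) : SignType.sign (a : ℤ) ≠ 0 := by
  rw [ne_eq, sign_eq_zero_iff]
  exact a.ne_zero

theorem isBasis_iff_of_mem_stratum {n r : ℕ} {P : RankTwoMatroid n} {σ : Fin n → ℤˣ}
    {S : Matrix (Fin n) (Fin n) ℝ} (hS : S ∈ kinematicStratum P σ r) (i j : Fin n) :
    P.IsBasis i j ↔ S i j ≠ 0 := by
  constructor
  · intro h h0
    have := hS.2.1 i j h
    rw [h0, sign_zero] at this
    exact sign_units_ne_zero _ this.symm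
  · intro h
    by_contra h0
    exact h (hS.2.2 i j h0)

/-- The non-zero entries of `S` are the bases, so `P = P'`. The quotient `σ_i σ'_i` agrees at both
ends of a basis; two elements of one part are joined through an element of another part, so it is
constant on the non-loops. -/
theorem setoid_of_mem_stratum {n r : ℕ} {P P' : RankTwoMatroid n} {σ σ' : Fin n → ℤˣ}
    {S : Matrix (Fin n) (Fin n) ℝ} (hS : S ∈ kinematicStratum P σ r)
    (hS' : S ∈ kinematicStratum P' σ' r) : (signedMatroidSetoid n).r (P, σ) (P', σ') := by
  have hP : P = P' := RankTwoMatroid.ext_isBasis fun i j => by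
    rw [isBasis_iff_of_mem_stratum hS, isBasis_iff_of_mem_stratum hS']
  subst hP
  refine ⟨rfl, ?_⟩
  change (∀ i ∈ P.support, σ i = σ' i) ∨ (∀ i ∈ P.support, σ i = - σ' i)
  have h1 : ∀ i j, P.IsBasis i j → σ i * σ' i = σ j * σ' j := by
    intro i j h
    have h2 : σ i * σ j = σ' i * σ' j :=
      sign_units_injective ((hS.2.1 i j h).symm.trans (hS'.2.1 i j h))
    calc σ i * σ' i = (σ i * σ j) * (σ j * σ' i) := by
          rw [mul_assoc, ← mul_assoc (σ j), ← pow_two, Int.units_sq, one_mul]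
      _ = σ j * σ' j := by
          rw [h2, mul_comm (σ j), ← mul_assoc, mul_assoc (σ' i), mul_comm (σ' j), ← mul_assoc,
            ← pow_two, Int.units_sq, one_mul, mul_comm]
  have h2 : ∀ i ∈ P.support, ∀ j ∈ P.support, σ i * σ' i = σ j * σ' j := by
    intro i hi j hj
    by_cases hij : P.partition.part i = P.partition.part j
    · obtain ⟨k, hk, hne⟩ := P.exists_part_ne (P.partition.part i)
      rw [h1 i k (RankTwoMatroid.isBasis_iff.2 ⟨hi, hk, hne.symm⟩),
        h1 j k (RankTwoMatroid.isBasis_iff.2 ⟨hj, hk, hij ▸ hne.symm⟩)]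
    · exact h1 i j (RankTwoMatroid.isBasis_iff.2 ⟨hi, hj, hij⟩)
  have h3 : ∀ i, σ i = (σ i * σ' i) * σ' i := fun i => by
    rw [mul_assoc, ← pow_two, Int.units_sq, mul_one]
  obtain ⟨i, hi, -⟩ := P.exists_part_ne ∅
  rcases Int.units_eq_one_or (σ i * σ' i) with h | h
  · refine .inl fun j hj => ?_
    rw [h3, h2 j hj i hi, h, one_mul]
  · refine .inr fun j hj => ?_
    rw [h3, h2 j hj i hi, h, neg_one_mul]

/-- The directions of the null vectors of a massless Mandelstam matrix as points of a sphere. -/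
theorem exists_directions {n r : ℕ} {S : Matrix (Fin n) (Fin n) ℝ} (hS : S ∈ masslessRegion n r) :
    ∃ (u : Fin n → ℝ) (g : Fin n → Fin (r - 1) → ℝ),
      (∀ i j, S i j = u i * u j * ((∑ e, (g i e - g j e) ^ 2) / 2)) ∧
      ∀ i, u i ≠ 0 → ∑ e, g i e ^ 2 = 1 := by
  obtain ⟨u, w, h⟩ := hS.1.exists_lorentz_gram
  have hw : ∀ i, ∑ e, w e i ^ 2 = u i ^ 2 := by
    intro i
    have h1 := h i i
    rw [hS.2 i] at h1
    simp only [pow_two]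
    linarith
  have hg : ∀ i, u i ≠ 0 → ∑ e, (w e i / u i) ^ 2 = 1 := by
    intro i hi
    simp only [div_pow]
    rw [← Finset.sum_div, hw, div_self (pow_ne_zero 2 hi)]
  have hw0 : ∀ i, u i = 0 → ∀ e, w e i = 0 := by
    intro i hi e
    have h1 := hw i
    rw [hi, zero_pow two_ne_zero, Finset.sum_eq_zero_iff_of_nonneg fun _ _ => sq_nonneg _] at h1
    exact pow_eq_zero_iff two_ne_zero |>.1 (h1 e (Finset.mem_univ e))
  -- If `u i = 0` then `w` vanishes at `i` too, so the value of the division by zero does not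
  -- matter.
  refine ⟨u, fun i e => w e i / u i, fun i j => ?_, hg⟩
  by_cases hi : u i = 0
  · rw [h, hi]
    simp [hw0 i hi]
  by_cases hj : u j = 0
  · rw [h, hj]
    simp [hw0 j hj]
  have h1 : ∑ e, (w e i / u i - w e j / u j) ^ 2 = ∑ e, (w e i / u i) ^ 2 +
      ∑ e, (w e j / u j) ^ 2 - 2 * (∑ e, w e i * w e j) / (u i * u j) := by
    rw [Finset.mul_sum, Finset.sum_div, ← Finset.sum_add_distrib, ← Finset.sum_sub_distrib]
    refine Finset.sum_congr rfl fun e _ => ?_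
    field_simp
    ring
  rw [h1, hg i hi, hg j hj, h i j]
  field_simp
  ring

theorem sum_sub_sq_pos {m : ℕ} {x y : Fin m → ℝ} (h : x ≠ y) : 0 < ∑ e, (x e - y e) ^ 2 := by
  refine (Finset.sum_nonneg fun _ _ => sq_nonneg _).lt_of_ne' fun h0 => h ?_
  rw [Finset.sum_eq_zero_iff_of_nonneg fun _ _ => sq_nonneg _] at h0
  funext e
  exact sub_eq_zero.1 (pow_eq_zero_iff two_ne_zero |>.1 (h0 e (Finset.mem_univ e)))

/-- Loops are the zeros of `u`, parts are the fibres of the direction `g`, and `σ` is the sign of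
`u`. With fewer than two directions `S` would be zero, against `r ≥ 1`. -/
theorem exists_mem_stratum {n r : ℕ} (hr : 1 ≤ r) {S : Matrix (Fin n) (Fin n) ℝ}
    (hS : S ∈ masslessRegion n r) :
    ∃ (P : RankTwoMatroid n) (σ : Fin n → ℤˣ), S ∈ kinematicStratum P σ r := by
  classical
  obtain ⟨u, g, h, -⟩ := exists_directions hS
  obtain ⟨P, -, hP⟩ := RankTwoMatroid.exists_isBasis_iff
    (Finset.univ.filter fun i => u i ≠ 0) g (by
      by_contra! hne
      have : S = 0 := by
        ext i j
        rw [h, Matrix.zero_apply]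
        by_cases hi : u i = 0
        · rw [hi]; ring
        by_cases hj : u j = 0
        · rw [hj]; ring
        rw [hne i (by simpa using hi) j (by simpa using hj)]
        simp
      have h1 := hS.1.rank_eq
      rw [this, Matrix.rank_zero] at h1
      omega)
  simp only [Finset.mem_filter, Finset.mem_univ, true_and] at hP
  refine ⟨P, fun i => if 0 < u i then 1 else -1, hS, fun i j hij => ?_, fun i j hij => ?_⟩
  · obtain ⟨hi, hj, hg⟩ := (hP i j).1 hij
    have hp := half_pos (sum_sub_sq_pos hg)
    rw [h]
    beta_reduce
    rcases lt_or_gt_of_ne hi with hi | hi <;> rcases lt_or_gt_of_ne hj with hj | hj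
    · rw [sign_pos (mul_pos (mul_pos_of_neg_of_neg hi hj) hp), if_neg hi.not_gt, if_neg hj.not_gt]
      rfl
    · rw [sign_neg (mul_neg_of_neg_of_pos (mul_neg_of_neg_of_pos hi hj) hp), if_neg hi.not_gt,
        if_pos hj]
      rfl
    · rw [sign_neg (mul_neg_of_neg_of_pos (mul_neg_of_pos_of_neg hi hj) hp), if_pos hi,
        if_neg hj.not_gt]
      rfl
    · rw [sign_pos (mul_pos (mul_pos hi hj) hp), if_pos hi, if_pos hj]
      rfl
  · rw [hP] at hij
    rw [h]
    by_cases hi : u i = 0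
    · rw [hi]; ring
    by_cases hj : u j = 0
    · rw [hj]; ring
    have hg : g i = g j := by
      by_contra hg
      exact hij ⟨hi, hj, hg⟩
    simp [hg]

/-- Elements of one part share a direction, so their rows are multiples of the row of a
representative, and `S` factors through a space with one coordinate per part. -/
theorem rank_le_numParts {n r : ℕ} {P : RankTwoMatroid n} {σ : Fin n → ℤˣ}
    {S : Matrix (Fin n) (Fin n) ℝ} (hS : S ∈ kinematicStratum P σ r) : r ≤ P.numParts := by
  classical
  obtain ⟨u, g, h, -⟩ := exists_directions hS.1
  have hb := isBasis_iff_of_mem_stratum hS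
  have hu : ∀ i ∈ P.support, u i ≠ 0 := by
    intro i hi h0
    obtain ⟨j, hj⟩ := RankTwoMatroid.mem_support_iff.1 hi
    apply (hb i j).1 hj
    rw [h, h0]
    ring
  choose rep hrep using fun A : P.partition.parts => P.partition.nonempty_of_mem_parts A.2
  have hreps : ∀ A, rep A ∈ P.support := fun A => P.partition.le A.2 (hrep A)
  let U : Matrix (Fin n) P.partition.parts ℝ :=
    Matrix.of fun i A => if i ∈ A.1 then u i / u (rep A) else 0
  let V : Matrix P.partition.parts (Fin n) ℝ := Matrix.of fun A j => S (rep A) j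
  have hUV : S = U * V := by
    ext i j
    rw [Matrix.mul_apply]
    simp only [U, V, Matrix.of_apply]
    by_cases hi : i ∈ P.support
    · have hA := P.partition.part_mem.2 hi
      rw [Finset.sum_eq_single ⟨P.partition.part i, hA⟩]
      · rw [if_pos (P.partition.mem_part hi)]
        set A : P.partition.parts := ⟨P.partition.part i, hA⟩
        have hg : g i = g (rep A) := by
          by_contra hne
          have h1 : S i (rep A) ≠ 0 := by
            rw [h]
            exact mul_ne_zero (mul_ne_zero (hu i hi) (hu _ (hreps A)))
              (half_pos (sum_sub_sq_pos hne)).ne'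
          have := (RankTwoMatroid.mem_part_iff hi).1 (hrep A)
          exact this.2 ((hb _ _).2 h1)
        have h0 := hu _ (hreps A)
        rw [h, h, hg]
        field_simp
      · intro A _ hAi
        rw [if_neg, zero_mul]
        intro hiA
        exact hAi (Subtype.ext (P.partition.part_eq_of_mem A.2 hiA).symm)
      · simp
    · have h0 : S i j = 0 := by
        by_contra hne
        exact hi ((hb i j).2 hne).mem_support.1
      rw [h0, Finset.sum_eq_zero]
      intro A _
      rw [if_neg, zero_mul]
      exact fun hiA => hi (P.partition.le A.2 hiA)
  rw [← hS.1.1.rank_eq, hUV]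
  refine (rank_mul_le_left _ _).trans ((rank_le_card_width _).trans ?_)
  simp [RankTwoMatroid.numParts]

/-- For `r = 1` directions have no coordinates, so all distances and hence `S` vanish. -/
theorem two_le_of_mem_masslessRegion {n r : ℕ} (hr : 1 ≤ r) {S : Matrix (Fin n) (Fin n) ℝ}
    (hS : S ∈ masslessRegion n r) : 2 ≤ r := by
  by_contra! hlt
  obtain rfl : r = 1 := by omega
  obtain ⟨u, g, h, -⟩ := exists_directions hS
  have h0 : S = 0 := by
    ext i j
    rw [h]
    simp
  have h1 := hS.1.rank_eq
  rw [h0, Matrix.rank_zero] at h1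
  omega

/-- Directions now lie on the sphere `{1, -1}`, which cannot hold three distinct points. -/
theorem numParts_le_two {n : ℕ} {P : RankTwoMatroid n} {σ : Fin n → ℤˣ}
    {S : Matrix (Fin n) (Fin n) ℝ} (hS : S ∈ kinematicStratum P σ 2) : P.numParts ≤ 2 := by
  by_contra! hlt
  obtain ⟨u, g, h, hg⟩ := exists_directions hS.1
  obtain ⟨A, hA, B, hB, C, hC, hAB, hAC, hBC⟩ := Finset.two_lt_card.1 hlt
  obtain ⟨i, hi⟩ := P.partition.nonempty_of_mem_parts hA
  obtain ⟨j, hj⟩ := P.partition.nonempty_of_mem_parts hB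
  obtain ⟨k, hk⟩ := P.partition.nonempty_of_mem_parts hC
  have hij := (isBasis_iff_of_mem_stratum hS i j).1 ⟨A, hA, B, hB, hAB, hi, hj⟩
  have hik := (isBasis_iff_of_mem_stratum hS i k).1 ⟨A, hA, C, hC, hAC, hi, hk⟩
  have hjk := (isBasis_iff_of_mem_stratum hS j k).1 ⟨B, hB, C, hC, hBC, hj, hk⟩
  have hone : ∀ i, u i ≠ 0 → g i 0 = 1 ∨ g i 0 = -1 := by
    intro i hi
    have := hg i hi
    rw [Fin.sum_univ_one] at this
    exact mul_self_eq_one_iff.1 (by rw [← pow_two]; exact this)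
  have key : ∀ i j, S i j ≠ 0 → u i ≠ 0 ∧ u j ≠ 0 ∧ g i 0 ≠ g j 0 := by
    intro i j hij
    rw [h, Fin.sum_univ_one] at hij
    refine ⟨fun h0 => hij (by rw [h0]; ring), fun h0 => hij (by rw [h0]; ring),
      fun h0 => hij ?_⟩
    rw [h0]
    ring
  obtain ⟨a1, a2, a3⟩ := key i j hij
  obtain ⟨b1, b2, b3⟩ := key i k hik
  obtain ⟨c1, c2, c3⟩ := key j k hjk
  rcases hone i a1 with x | x <;> rcases hone j a2 with y | y <;> rcases hone k b2 with z | z <;>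
    simp_all

/-! ### Non-emptiness and dimension of the strata. -/

theorem entry_mem_stratum {n N k : ℕ} {P : RankTwoMatroid n} {σ : Fin n → ℤˣ} (ℓ : Labelling n N)
    (hb : ∀ i j, ℓ.Basis i j ↔ P.IsBasis i j) (hkN : k ≤ N) (hk : 0 < N → 0 < k)
    {t : ℓ.ParamIndex k → ℝ} (ht : ∀ j, t j ∈ ℓ.box σ j) :
    Matrix.of (ℓ.entry t) ∈ kinematicStratum P σ (k + 2) :=
  ⟨⟨ℓ.isMandelstam_entry hkN (ℓ.ne_zero_of_mem_box ht), fun i => ℓ.entry_self t i⟩,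
    fun i j hij => ℓ.sign_entry_of_mem_box hk ht ((hb i j).2 hij),
    fun i j hij => ℓ.entry_of_not_basis t fun h => hij ((hb i j).1 h)⟩

theorem exists_eq_entry {n N k : ℕ} {P : RankTwoMatroid n} {σ : Fin n → ℤˣ} (ℓ : Labelling n N)
    (hb : ∀ i j, ℓ.Basis i j ↔ P.IsBasis i j) {S : Matrix (Fin n) (Fin n) ℝ}
    (hS : S ∈ kinematicStratum P σ (k + 2)) :
    ∃ t : ℓ.ParamIndex k → ℝ, ∀ i j, S i j = ℓ.entry t i j := by
  obtain ⟨u, w, h⟩ := hS.1.1.exists_lorentz_gram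
  exact ℓ.exists_entry_eq h hS.1.2 hS.1.1.rank_eq.le fun i j => by
    rw [hb, isBasis_iff_of_mem_stratum hS]

theorem matrixDim_stratum {n N k : ℕ} {P : RankTwoMatroid n} (σ : Fin n → ℤˣ)
    (ℓ : Labelling n N) (hb : ∀ i j, ℓ.Basis i j ↔ P.IsBasis i j) (hkN : k ≤ N)
    (hk : 0 < N → 0 < k) :
    matrixDim (kinematicStratum P σ (k + 2)) = (Fintype.card (ℓ.ParamIndex k) : WithBot ℕ∞) := by
  have heval : ∀ (t : ℓ.ParamIndex k → ℝ) (i j : Fin n), eval t (ℓ.entry X i j) = ℓ.entry t i j := by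
    intro t i j
    rw [ℓ.map_entry]
    congr 1
    ext q
    simp
  refine semialgebraicDim_eq_card (fun p : Fin n × Fin n => ℓ.entry X p.1 p.2) _ (ℓ.box σ)
    (ℓ.box_infinite σ) (fun t ht => ?_) (fun x hx => ?_) (fun K hK hsq => ?_)
  · simp only [Set.mem_ofPred_eq, heval]
    exact entry_mem_stratum ℓ hb hkN hk fun j => ht j (Set.mem_univ j)
  · obtain ⟨t, ht⟩ := exists_eq_entry ℓ hb hx
    refine ⟨t, funext fun p => ?_⟩
    rw [heval]
    exact ht p.1 p.2
  · refine ℓ.param_mem (fun j => ?_) (fun i j => ?_) hsq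
    · exact (map_ne_zero_iff _ (IsFractionRing.injective _ _)).2 (X_ne_zero j)
    · have := hK (i, j)
      rwa [ℓ.map_entry] at this

theorem stratum_nonempty {n N k : ℕ} {P : RankTwoMatroid n} (σ : Fin n → ℤˣ) (ℓ : Labelling n N)
    (hb : ∀ i j, ℓ.Basis i j ↔ P.IsBasis i j) (hkN : k ≤ N) (hk : 0 < N → 0 < k) :
    (kinematicStratum P σ (k + 2)).Nonempty := by
  choose t ht using fun j : ℓ.ParamIndex k => (ℓ.box_infinite σ j).nonempty
  exact ⟨_, entry_mem_stratum ℓ hb hkN hk ht⟩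

theorem stratum_nonempty_iff {n r : ℕ} (hr : 1 ≤ r) (P : RankTwoMatroid n) (σ : Fin n → ℤˣ) :
    (kinematicStratum P σ r).Nonempty ↔
      (3 ≤ r ∧ r ≤ P.numParts) ∨ (r = 2 ∧ P.numParts = 2) := by
  have hm : 2 ≤ P.numParts := P.two_le_card
  constructor
  · rintro ⟨S, hS⟩
    have h1 := two_le_of_mem_masslessRegion hr hS.1
    have h2 := rank_le_numParts hS
    by_cases h : r = 2
    · subst h
      exact .inr ⟨rfl, (numParts_le_two hS).antisymm h2⟩
    · exact .inl ⟨by omega, h2⟩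
  · intro h
    obtain ⟨ℓ, -, hb⟩ := P.exists_labelling (N := P.numParts - 2) (by omega)
    obtain ⟨k, rfl⟩ : ∃ k, r = k + 2 := ⟨r - 2, by omega⟩
    exact stratum_nonempty σ ℓ hb (by omega) (by omega)

end Kinematic

theorem theorem3p1 (n r : ℕ) (hr : 1 ≤ r) :
    (Kinematic.masslessRegion n r = ⋃ Q : Kinematic.SignedMatroid n, Q.stratum r) ∧
    (∀ Q Q' : Kinematic.SignedMatroid n, Q ≠ Q' → Disjoint (Q.stratum r) (Q'.stratum r)) ∧
    ∀ (P : Kinematic.RankTwoMatroid n) (σ : Fin n → ℤˣ),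
      ((Kinematic.kinematicStratum P σ r).Nonempty ↔
        (3 ≤ r ∧ r ≤ P.numParts) ∨ (r = 2 ∧ P.numParts = 2)) ∧
      ((Kinematic.kinematicStratum P σ r).Nonempty →
        ∃ d : ℕ, Kinematic.matrixDim (Kinematic.kinematicStratum P σ r) = (d : WithBot ℕ∞) ∧
          (d : ℤ) = (P.numParts : ℤ) * ((r : ℤ) - 2) + (n : ℤ) - (P.numLoops : ℤ)
            - (r.choose 2 : ℤ)) := by
  refine ⟨?_, ?_, fun P σ => ⟨Kinematic.stratum_nonempty_iff hr P σ, fun hne => ?_⟩⟩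
  · ext S
    rw [Set.mem_iUnion]
    constructor
    · intro hS
      obtain ⟨P, σ, h⟩ := Kinematic.exists_mem_stratum hr hS
      exact ⟨Quotient.mk _ (P, σ), h⟩
    · rintro ⟨Q, hQ⟩
      induction Q using Quotient.inductionOn with
      | _ x => exact hQ.1
  · intro Q Q'
    induction Q using Quotient.inductionOn with
    | _ x =>
      induction Q' using Quotient.inductionOn with
      | _ y =>
        intro hne
        rw [Set.disjoint_left]
        intro S hS hS'
        exact hne (Quotient.sound (Kinematic.setoid_of_mem_stratum hS hS'))
  · have h := (Kinematic.stratum_nonempty_iff hr P σ).1 hne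
    have hm : 2 ≤ P.numParts := P.two_le_card
    obtain ⟨N, hN⟩ : ∃ N, P.numParts = N + 2 := ⟨P.numParts - 2, by omega⟩
    obtain ⟨ℓ, hs, hb⟩ := P.exists_labelling hN
    obtain ⟨k, rfl⟩ : ∃ k, r = k + 2 := ⟨r - 2, by omega⟩
    refine ⟨_, Kinematic.matrixDim_stratum σ ℓ hb (by omega) (by omega), ?_⟩
    rw [ℓ.card_paramIndex (by omega), hN]
    have h1 : (Finset.univ.filter fun i => ℓ.c i ≠ 0) = P.support := by
      ext i
      simp [hs]
    have h2 := P.card_support_add_numLoops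
    -- The terms `2k + 1` account for the passage from `m` to `N = m - 2` points and for the
    -- normalised scale.
    have h3 : ((k + 2).choose 2 : ℤ) = k.choose 2 + 2 * k + 1 := by
      have : (k + 2).choose 2 = k.choose 2 + 2 * k + 1 := by
        rw [Nat.choose_succ_succ' (k + 1) 1, Nat.choose_succ_succ' k 1, Nat.choose_one_right,
          Nat.choose_one_right]
        ring
      rw [this]
      push_cast
      ring
    rw [h1, h3]
    push_cast
    have h4 : (n : ℤ) = P.support.card + P.numLoops := by exact_mod_cast h2.symm
    rw [h4]
    ring
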